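/- Let $V$ be an irreducible (integral, separated, finite type) variety over a field $k$ of characteristic zero, with function field $K$, let $\mathcal L\subset \mathrm{Der}_k(K,K)$ be a $K$-linear subspace (for instance a $K$-linear Lie subalgebra, i.e. a singular foliation), and let $r=\dim_K\mathcal L$. For quasi-coherent sheaves put $AB=(A\otimes B)/\mathrm{torsion}$, $A^0=\mathcal O_V$, $A^{n+1}=A^nA$. Let $\Omega$ be the image of $\mathrm{ev}:\Omega_{V/k}\to \mathrm{Hom}_K(\mathcal L,K)$, $da\mapsto(\delta\mapsto\delta(a))$. For a torsion free rank one coherent sheaf $I$ let $0\to I\Omega\to P(I)\to I\to 0$ be the extension defined by the image of the Atiyah class of $I$, that is, $P(I)=I\oplus I\Omega$ with $\mathcal O_V$-action $a(s,\beta)=(as,\,a\beta-s\,da)$, and let $F(I)=\Lambda^{r+1}P(I)/\mathrm{torsion}$. For local sections $f_0,\dots,f_r$ of $I$ let $w(f_0,\dots,f_r)=(f_0,0)\wedge\cdots\wedge(f_r,0)\in F(I)$; when $I\subset K$ and $\delta_1,\dots,\delta_r$ is a basis of $\mathcal L$, this corresponds to the determinant with rows $(f_i,\delta_1f_i,\dots,\delta_rf_i)$.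 Define $J_0=I$, $L_s=F(J_s)$, $J_{s+1}=J_sL_s=IL_0\cdots L_s$, and $R_i=L_0^{a_0}L_1^{a_1}\cdots L_s^{a_s}$, where $i=\sum_\alpha a_\alpha(r+2)^\alpha$ with $0\le a_\alpha<r+2$ (so $R_0=\mathcal O_V$). Then there are maps of $\mathcal O_V$-modules $\nu_s:L_s^{r+2}\to L_{s+1}$ and multiplication maps $R_iR_j\to R_{i+j}$, for every such $I$ and all $s,i,j\ge 0$, with the following properties. (1) $\nu_s$ is the unique $\mathcal O_V$-linear map such that for all local sections $f_0,\dots,f_r$ of $J_s$ and $h=w(f_0,\dots,f_r)$ one has $\nu_s(h^{r+2})=w(hf_0,\dots,hf_r)$. Moreover $\nu_s(h^{r+1}w(f_0,\dots,f_r))=w(hf_0,\dots,hf_r)$ for every local section $h$ of $L_s$. (2) The multiplication maps make $R=\bigoplus_i R_i$ a graded sheaf of commutative $\mathcal O_V$-algebras, whose unit map $\mathcal O_V\to R_0$ is the identity. The multiplication is given by carrying in base $r+2$ along the $\nu_s$: a product of local sections of the $L_\alpha$ ($a_\alpha$ factors from $L_\alpha=R_{(r+2)^\alpha}$), formed in $R_i=L_0^{a_0}\cdots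 L_s^{a_s}$, equals their product in $R$; and the product in $R$ of $r+2$ local sections $y_1,\dots,y_{r+2}$ of $L_s$ equals $\nu_s(y_1\cdots y_{r+2})\in L_{s+1}=R_{(r+2)^{s+1}}$. It is the only graded $\mathcal O_V$-algebra structure on $R$ with these two properties. (3) The maps $\nu_s$ and the multiplication maps are natural with respect to all morphisms $I\to I'$ of torsion free rank one coherent sheaves. -/

import Mathlib

open CategoryTheory AlgebraicGeometry TopologicalSpace Opposite
open scoped TensorProduct DirectSum

universe u

noncomputable section

namespace Foliation

variable {V : Scheme.{u}} [IsIntegral V]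

/-- The generic point lies in every nonempty open set. -/
theorem generic_mem {U : V.Opens} {x : V} (hx : x ∈ U) : genericPoint V ∈ U :=
  ((genericPoint_spec V).mem_open_set_iff U.isOpen).mpr ⟨x, trivial, hx⟩

/-- The local ring `𝒪_{V,x}`, as a subring of the function field. -/
def localRing (x : V) : Subring V.functionField :=
  (algebraMap (V.presheaf.stalk x) V.functionField).range

/-- The rational function defined by a regular function on an open set containing a point `x`. -/
def toRat {U : V.Opens} {x : V} (hx : x ∈ U) : Γ(V, U) →+* V.functionField :=
  (V.presheaf.germ U (genericPoint V) (generic_mem hx)).hom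

theorem toRat_mem {U : V.Opens} {x : V} (hx : x ∈ U) (a : Γ(V, U)) :
    toRat hx a ∈ localRing x := by
  have : Nonempty U := ⟨⟨x, hx⟩⟩
  exact ⟨V.presheaf.germ U x hx a, V.algebraMap_germ_eq_germToFunctionField hx a⟩

theorem toRat_res {U U' : V.Opens} (i : U' ⟶ U) {x : V} (hx : x ∈ U') (a : Γ(V, U)) :
    toRat hx (V.presheaf.map i.op a) = toRat (i.le hx) a :=
  V.presheaf.germ_res_apply i _ (generic_mem hx) a

variable (W : Type u) [AddCommGroup W] [Module V.functionField W]

/-- Locally constant `W`-valued functions on `U` whose value at `x` lies in `N x`. -/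
def latticeSections (N : ∀ x : V, Submodule (localRing x) W) (U : V.Opens) :
    AddSubgroup (U → W) where
  carrier := {f | IsLocallyConstant f ∧ ∀ x : U, f x ∈ N x}
  zero_mem' := ⟨IsLocallyConstant.const 0, fun x => (N x).zero_mem⟩
  add_mem' h h' := ⟨h.1.add h'.1, fun x => (N x).add_mem (h.2 x) (h'.2 x)⟩
  neg_mem' h := ⟨h.1.neg, fun x => (N x).neg_mem (h.2 x)⟩

theorem toRat_irrel {U : V.Opens} {x y : V} (hx : x ∈ U) (hy : y ∈ U) :
    toRat hx = toRat hy := rfl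

instance (N : ∀ x : V, Submodule (localRing x) W) (U : V.Opens) :
    Module Γ(V, U) (latticeSections W N U) where
  smul a f := ⟨fun x => toRat x.2 a • f.1 x, by
    constructor
    · refine (IsLocallyConstant.iff_exists_open _).2 fun x => ?_
      obtain ⟨O, hO, hx, h⟩ := (IsLocallyConstant.iff_exists_open _).1 f.2.1 x
      exact ⟨O, hO, hx, fun y hy => by rw [h y hy]; rfl⟩
    · exact fun x => (N x).smul_mem ⟨_, toRat_mem x.2 a⟩ (f.2.2 x)⟩
  one_smul f := Subtype.ext <| funext fun x => by
    change toRat x.2 1 • f.1 x = f.1 x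
    rw [map_one, one_smul]
  mul_smul a b f := Subtype.ext <| funext fun x => by
    change toRat x.2 (a * b) • f.1 x = toRat x.2 a • toRat x.2 b • f.1 x
    rw [map_mul, mul_smul]
  smul_zero a := Subtype.ext <| funext fun x => smul_zero _
  smul_add a f g := Subtype.ext <| funext fun x => smul_add _ _ _
  add_smul a b f := Subtype.ext <| funext fun x => by
    change toRat x.2 (a + b) • f.1 x = toRat x.2 a • f.1 x + toRat x.2 b • f.1 x
    rw [map_add, add_smul]
  zero_smul f := Subtype.ext <| funext fun x => by
    change toRat x.2 0 • f.1 x = 0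
    rw [map_zero, zero_smul]

/-- The condition that cuts out `latticeSections`, as a local predicate on `W`-valued functions. -/
def latticePredicate (N : ∀ x : V, Submodule (localRing x) W) :
    TopCat.LocalPredicate (X := V.toTopCat) (fun _ : V => W) where
  pred {U} f := IsLocallyConstant f ∧ ∀ x : U, f x ∈ N x.1
  res i f h := ⟨h.1.comp_continuous (Opens.isOpenEmbedding_of_le i.le).continuous,
    fun x => h.2 (i x)⟩
  locality {U} f h := by
    refine ⟨(IsLocallyConstant.iff_exists_open _).2 fun x => ?_, fun x => ?_⟩
    · obtain ⟨O, hx, i, hO⟩ := h x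
      obtain ⟨O', hO', hx', h'⟩ := (IsLocallyConstant.iff_exists_open _).1 hO.1 ⟨x, hx⟩
      have e := (Opens.isOpenEmbedding_of_le i.le)
      refine ⟨_, e.isOpenMap _ hO', ⟨⟨x, hx⟩, hx', rfl⟩, ?_⟩
      rintro _ ⟨y, hy, rfl⟩
      exact h' y hy
    · obtain ⟨O, hx, i, hO⟩ := h x
      exact hO.2 ⟨x, hx⟩

/-- The presheaf of abelian groups `U ↦ latticeSections W N U`. -/
def latticePresheaf (N : ∀ x : V, Submodule (localRing x) W) : TopCat.Presheaf Ab V where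
  obj U := AddCommGrpCat.of (latticeSections W N U.unop)
  map i := AddCommGrpCat.ofHom
    { toFun := fun f => ⟨fun x => f.1 (i.unop x), (latticePredicate W N).res i.unop f.1 f.2⟩
      map_zero' := rfl
      map_add' := fun _ _ => rfl }

/-- The subsheaf of `𝒪_V`-modules of the constant sheaf `W` with prescribed stalks `N x`:
its sections over `U` are the locally constant functions `U → W` (so, `V` being irreducible, one
element of `W` if `U` is nonempty, and the zero module if `U` is empty) with values in `N x`. -/
def latticeSheaf (N : ∀ x : V, Submodule (localRing x) W) : V.Modules where
  val :=
    letI : ∀ U : V.Opensᵒᵖ, Module (V.ringCatSheaf.obj.obj U) ((latticePresheaf W N).obj U) :=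
      fun U => inferInstanceAs (Module Γ(V, U.unop) (latticeSections W N U.unop))
    PresheafOfModules.ofPresheaf (latticePresheaf W N) (fun U U' i a f =>
      Subtype.ext <| funext fun x => by
        exact congrArg (· • f.1 (i.unop x)) (toRat_res i.unop x.2 a).symm)
  isSheaf := (TopCat.Presheaf.isSheaf_iff_isSheaf_comp (forget Ab) (latticePresheaf W N)).2
    (TopCat.subpresheafToTypes.isSheaf (latticePredicate W N))


variable {W} in
/-- The section of a lattice sheaf given by a constant function. -/
def constSec {N : ∀ x : V, Submodule (localRing x) W} (U : V.Opens) (f : U → W)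
    (hf : ∀ x y, f x = f y) (hN : ∀ x : U, f x ∈ N x) : Γ(latticeSheaf W N, U) :=
  (⟨f, IsLocallyConstant.of_constant f hf, hN⟩ : latticeSections W N U)

variable {W} in
/-- The morphism induced by a linear map that respects the prescribed stalks. -/
def latticeMap {W' : Type u} [AddCommGroup W'] [Module V.functionField W']
    {N : ∀ x : V, Submodule (localRing x) W} {N' : ∀ x : V, Submodule (localRing x) W'}
    (g : W →ₗ[V.functionField] W') (hg : ∀ x, ∀ w ∈ N x, g w ∈ N' x) :
    latticeSheaf W N ⟶ latticeSheaf W' N' :=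
  ⟨PresheafOfModules.homMk (M₁ := (latticeSheaf W N).val) (M₂ := (latticeSheaf W' N').val)
    { app := fun U => AddCommGrpCat.ofHom
        { toFun := fun f : latticeSections W N U.unop =>
            (⟨fun x => g (f.1 x), f.2.1.comp g, fun x => hg _ _ (f.2.2 x)⟩ :
              latticeSections W' N' U.unop)
          map_zero' := Subtype.ext <| funext fun _ => map_zero g
          map_add' := fun _ _ => Subtype.ext <| funext fun _ => map_add g _ _ }
      naturality := fun _ _ _ => rfl }
    (fun _ _ _ => Subtype.ext <| funext fun _ => map_smul g _ _)⟩

section fibre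

variable (M N : V.Modules)

/-- The stalk of a sheaf of modules at the generic point, a vector space over the function
field. -/
def GenericFiber : Type u := ↑(M.presheaf.stalk (genericPoint V))

instance : AddCommGroup (GenericFiber M) :=
  inferInstanceAs (AddCommGroup (M.presheaf.stalk (genericPoint V)))

instance : Module V.functionField (GenericFiber M) :=
  letI M' : PresheafOfModules.{u} (V.presheaf ⋙ forget₂ CommRingCat.{u} RingCat.{u}) := M.val
  inferInstanceAs (Module (V.presheaf.stalk (genericPoint V))
    ↑(TopCat.Presheaf.stalk (C := Ab.{u}) (X := V.toTopCat) M'.presheaf (genericPoint V)))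

variable {M N}

/-- The germ at the generic point of a section over an open set containing a point `x`. -/
def gen {U : V.Opens} {x : V} (hx : x ∈ U) : Γ(M, U) →+ GenericFiber M :=
  (M.presheaf.germ U (genericPoint V) (generic_mem hx)).hom

theorem gen_smul {U : V.Opens} {x : V} (hx : x ∈ U) (a : Γ(V, U)) (s : Γ(M, U)) :
    gen hx (a • s) = toRat hx a • gen hx s :=
  PresheafOfModules.germ_smul (R := V.presheaf) M.val _ U (generic_mem hx) a s

theorem gen_res {U U' : V.Opens} (i : U' ⟶ U) {x : V} (hx : x ∈ U') (s : Γ(M, U)) :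
    gen hx (M.presheaf.map i.op s) = gen (i.le hx) s :=
  M.presheaf.germ_res_apply i _ (generic_mem hx) s

theorem exists_gen (m : GenericFiber M) :
    ∃ (U : V.Opens) (h : genericPoint V ∈ U) (s : Γ(M, U)), gen h s = m :=
  M.presheaf.exists_germ_eq m

theorem exists_toRat (a : V.functionField) :
    ∃ (U : V.Opens) (h : genericPoint V ∈ U) (s : Γ(V, U)), toRat h s = a :=
  V.presheaf.exists_germ_eq a

/-- The additive map on generic fibres induced by a morphism. -/
def genericAddMap (φ : M ⟶ N) : GenericFiber M →+ GenericFiber N :=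
  ((TopCat.Presheaf.stalkFunctor Ab (genericPoint V)).map φ.mapPresheaf).hom

theorem genericAddMap_gen (φ : M ⟶ N) {U : V.Opens} {x : V} (hx : x ∈ U) (s : Γ(M, U)) :
    genericAddMap φ (gen hx s) = gen hx (φ.app U s) :=
  TopCat.Presheaf.stalkFunctor_map_germ_apply U _ (generic_mem hx) φ.mapPresheaf s

/-- The linear map on generic fibres induced by a morphism. -/
def genericMap (φ : M ⟶ N) : GenericFiber M →ₗ[V.functionField] GenericFiber N where
  __ := genericAddMap φ
  map_smul' a m := by
    obtain ⟨U, hU, s, rfl⟩ := exists_gen m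
    obtain ⟨U', hU', b, rfl⟩ := exists_toRat a
    have h : genericPoint V ∈ U ⊓ U' := ⟨hU, hU'⟩
    have key : toRat hU' b • gen hU s = gen h (V.presheaf.map (Opens.infLERight U U').op b •
        M.presheaf.map (Opens.infLELeft U U').op s) := by
      rw [gen_smul, toRat_res, gen_res]
    have h1 : genericAddMap φ (gen hU s) =
        genericAddMap φ (gen h (M.presheaf.map (Opens.infLELeft U U').op s)) := by
      rw [gen_res]
    change genericAddMap φ (toRat hU' b • gen hU s) = toRat hU' b • genericAddMap φ (gen hU s)
    rw [key, h1, genericAddMap_gen, genericAddMap_gen, Scheme.Modules.Hom.app_smul, gen_smul,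
      toRat_res]

theorem genericMap_gen (φ : M ⟶ N) {U : V.Opens} {x : V} (hx : x ∈ U) (s : Γ(M, U)) :
    genericMap φ (gen hx s) = gen hx (φ.app U s) :=
  genericAddMap_gen φ hx s

/-- The image of the stalk `M_x` in the generic fibre of `M`. -/
def stalkImage (M : V.Modules) (x : V) : Set (GenericFiber M) :=
  {m | ∃ (U : V.Opens) (hx : x ∈ U) (s : Γ(M, U)), gen hx s = m}

theorem map_stalkImage (φ : M ⟶ N) {x : V} {m : GenericFiber M} (hm : m ∈ stalkImage M x) :
    genericMap φ m ∈ stalkImage N x := by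
  obtain ⟨U, hx, s, rfl⟩ := hm
  exact ⟨U, hx, φ.app U s, (genericMap_gen φ hx s).symm⟩

end fibre


section product

/-- The product `AB = (A ⊗ B)/torsion`. On an integral scheme the torsion of a quasi-coherent sheaf
is the kernel of the map to the constant sheaf given by its generic fibre, so `AB` is the image of
`A ⊗ B` in the constant sheaf `A_η ⊗ B_η`: its stalk at `x` is the `𝒪_{V,x}`-span of the tensors
`a ⊗ b` with `a ∈ A_x`, `b ∈ B_x`. -/
def prodSheaf (A B : V.Modules) : V.Modules :=
  latticeSheaf (GenericFiber A ⊗[V.functionField] GenericFiber B) fun x =>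
    Submodule.span (localRing x)
      {t | ∃ a ∈ stalkImage A x, ∃ b ∈ stalkImage B x, a ⊗ₜ[V.functionField] b = t}

variable {A B A' B' : V.Modules}

/-- The product `st ∈ Γ(AB, U)` of `s ∈ Γ(A, U)` and `t ∈ Γ(B, U)`, i.e. the class of `s ⊗ t`. -/
def mulSec (U : V.Opens) :
    Γ(A, U) →ₗ[Γ(V, U)] Γ(B, U) →ₗ[Γ(V, U)] Γ(prodSheaf A B, U) :=
  LinearMap.mk₂ Γ(V, U)
    (fun s t => constSec U (fun x => gen x.2 s ⊗ₜ gen x.2 t) (fun _ _ => rfl)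
      fun x => Submodule.subset_span ⟨_, ⟨U, x.2, s, rfl⟩, _, ⟨U, x.2, t, rfl⟩, rfl⟩)
    (fun s s' t => Subtype.ext <| funext fun x => by
      change gen x.2 (s + s') ⊗ₜ _ = gen x.2 s ⊗ₜ _ + gen x.2 s' ⊗ₜ _
      rw [map_add, TensorProduct.add_tmul])
    (fun a s t => Subtype.ext <| funext fun x => by
      change gen x.2 (a • s) ⊗ₜ _ = toRat x.2 a • (gen x.2 s ⊗ₜ _)
      rw [gen_smul, TensorProduct.smul_tmul'])
    (fun s t t' => Subtype.ext <| funext fun x => by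
      change _ ⊗ₜ gen x.2 (t + t') = _ ⊗ₜ gen x.2 t + _ ⊗ₜ gen x.2 t'
      rw [map_add, TensorProduct.tmul_add])
    (fun a s t => Subtype.ext <| funext fun x => by
      change _ ⊗ₜ gen x.2 (a • t) = toRat x.2 a • (_ ⊗ₜ gen x.2 t)
      rw [gen_smul, TensorProduct.tmul_smul])

/-- Functoriality of the product. -/
def prodMap (φ : A ⟶ A') (ψ : B ⟶ B') : prodSheaf A B ⟶ prodSheaf A' B' :=
  latticeMap (TensorProduct.map (genericMap φ) (genericMap ψ)) fun x w hw => by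
    induction hw using Submodule.span_induction with
    | mem w h =>
      obtain ⟨a, ha, b, hb, rfl⟩ := h
      exact Submodule.subset_span ⟨_, map_stalkImage φ ha, _, map_stalkImage ψ hb, rfl⟩
    | zero => rw [map_zero]; exact Submodule.zero_mem _
    | add _ _ _ _ h h' => rw [map_add]; exact Submodule.add_mem _ h h'
    | smul a w _ h =>
      change TensorProduct.map (genericMap φ) (genericMap ψ) ((a : V.functionField) • w) ∈ _
      rw [map_smul]
      exact Submodule.smul_mem _ a h

theorem prodMap_mulSec (φ : A ⟶ A') (ψ : B ⟶ B') (U : V.Opens) (s : Γ(A, U)) (t : Γ(B, U)) :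
    (prodMap φ ψ).app U (mulSec U s t) = mulSec U (φ.app U s) (ψ.app U t) :=
  Subtype.ext <| funext fun x => by
    change TensorProduct.map (genericMap φ) (genericMap ψ) (gen x.2 s ⊗ₜ gen x.2 t) =
      gen x.2 (φ.app U s) ⊗ₜ gen x.2 (ψ.app U t)
    rw [TensorProduct.map_tmul, genericMap_gen, genericMap_gen]

theorem mulSec_res {U U' : V.Opens} (i : U' ⟶ U) (s : Γ(A, U)) (t : Γ(B, U)) :
    (prodSheaf A B).presheaf.map i.op (mulSec U s t) =
      mulSec U' (A.presheaf.map i.op s) (B.presheaf.map i.op t) :=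
  Subtype.ext <| funext fun x => by
    change gen _ s ⊗ₜ gen _ t = gen x.2 (A.presheaf.map i.op s) ⊗ₜ gen x.2 (B.presheaf.map i.op t)
    rw [gen_res, gen_res]

end product

section exterior

/-- The exterior power `Λⁿ M` modulo torsion, i.e. the image of `Λⁿ M` in the constant sheaf
`Λⁿ M_η`. -/
def extSheaf (n : ℕ) (M : V.Modules) : V.Modules :=
  latticeSheaf (⋀[V.functionField]^n (GenericFiber M)) fun x =>
    Submodule.span (localRing x)
      {t | ∃ m : Fin n → GenericFiber M, (∀ i, m i ∈ stalkImage M x) ∧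
        exteriorPower.ιMulti V.functionField n m = t}

variable {M M' : V.Modules}

/-- The class of `s₁ ∧ ⋯ ∧ sₙ` in `Λⁿ M` modulo torsion. -/
def wedgeSec (n : ℕ) (U : V.Opens) (s : Fin n → Γ(M, U)) : Γ(extSheaf n M, U) :=
  constSec U (fun x => exteriorPower.ιMulti V.functionField n fun i => gen x.2 (s i))
    (fun _ _ => rfl) fun x => Submodule.subset_span ⟨_, fun i => ⟨U, x.2, s i, rfl⟩, rfl⟩

/-- Functoriality of the exterior power modulo torsion. -/
def extMap (n : ℕ) (φ : M ⟶ M') : extSheaf n M ⟶ extSheaf n M' :=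
  latticeMap (exteriorPower.map n (genericMap φ)) fun x w hw => by
    induction hw using Submodule.span_induction with
    | mem w h =>
      obtain ⟨m, hm, rfl⟩ := h
      rw [exteriorPower.map_apply_ιMulti]
      exact Submodule.subset_span ⟨_, fun i => map_stalkImage φ (hm i), rfl⟩
    | zero => rw [map_zero]; exact Submodule.zero_mem _
    | add _ _ _ _ h h' => rw [map_add]; exact Submodule.add_mem _ h h'
    | smul a w _ h =>
      change exteriorPower.map n (genericMap φ) ((a : V.functionField) • w) ∈ _
      rw [map_smul]
      exact Submodule.smul_mem _ a h

end exterior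

section fol

variable {k : Type u} [Field k] [V.Over (Spec (.of k))]

variable (k) in
/-- The inclusion of the base field into the function field, from the structure morphism. -/
def constants : k →+* V.functionField :=
  (V.presheaf.germ ⊤ (genericPoint V) trivial).hom.comp
    (((V ↘ Spec (.of k)).appTop).hom.comp (Scheme.ΓSpecIso (.of k)).inv.hom)

/-- The function field of a `k`-scheme is a `k`-algebra. -/
instance : Algebra k V.functionField := (constants k).toAlgebra

variable (𝓛 : Submodule V.functionField (Derivation k V.functionField V.functionField))

/-- The evaluation `da ↦ (δ ↦ δ a)` with values in the dual of `𝓛`. -/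
def ev (a : V.functionField) : Module.Dual V.functionField 𝓛 where
  toFun δ := δ.1 a
  map_add' _ _ := rfl
  map_smul' _ _ := rfl

theorem ev_add (a b : V.functionField) : ev 𝓛 (a + b) = ev 𝓛 a + ev 𝓛 b :=
  LinearMap.ext fun δ => map_add δ.1 a b

theorem ev_mul (a b : V.functionField) : ev 𝓛 (a * b) = a • ev 𝓛 b + b • ev 𝓛 a :=
  LinearMap.ext fun δ => δ.1.leibniz a b

/-- The sheaf `Ω` of differentials along the foliation: the image of the evaluation map from
`Ω_{V/k}` to the constant sheaf given by the dual of `𝓛`. -/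
def Omega : V.Modules :=
  latticeSheaf (Module.Dual V.functionField 𝓛) fun x =>
    Submodule.span (localRing x) (ev 𝓛 '' (localRing x : Set V.functionField))

/-- The differential `da ∈ Γ(Ω, U)` of a regular function. -/
def dSec (U : V.Opens) (a : Γ(V, U)) : Γ(Omega 𝓛, U) :=
  constSec U (fun x => ev 𝓛 (toRat x.2 a)) (fun _ _ => rfl)
    fun x => Submodule.subset_span ⟨_, toRat_mem x.2 a, rfl⟩

theorem dSec_add (U : V.Opens) (a b : Γ(V, U)) : dSec 𝓛 U (a + b) = dSec 𝓛 U a + dSec 𝓛 U b :=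
  Subtype.ext <| funext fun x => by
    change ev 𝓛 (toRat x.2 (a + b)) = ev 𝓛 (toRat x.2 a) + ev 𝓛 (toRat x.2 b)
    rw [map_add, ev_add]

theorem dSec_mul (U : V.Opens) (a b : Γ(V, U)) :
    dSec 𝓛 U (a * b) = a • dSec 𝓛 U b + b • dSec 𝓛 U a :=
  Subtype.ext <| funext fun x => by
    change ev 𝓛 (toRat x.2 (a * b)) =
      toRat x.2 a • ev 𝓛 (toRat x.2 b) + toRat x.2 b • ev 𝓛 (toRat x.2 a)
    rw [map_mul, ev_mul]

theorem dSec_one (U : V.Opens) : dSec 𝓛 U 1 = 0 := by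
  have h := dSec_mul 𝓛 U 1 1
  rw [mul_one, one_smul] at h
  exact left_eq_add.mp h

theorem dSec_res {U U' : V.Opens} (i : U' ⟶ U) (a : Γ(V, U)) :
    (Omega 𝓛).presheaf.map i.op (dSec 𝓛 U a) = dSec 𝓛 U' (V.presheaf.map i.op a) :=
  Subtype.ext <| funext fun x => by
    change ev 𝓛 (toRat _ a) = ev 𝓛 (toRat x.2 (V.presheaf.map i.op a))
    rw [toRat_res]

end fol


section principal

variable {k : Type u} [Field k] [V.Over (Spec (.of k))]
variable (𝓛 : Submodule V.functionField (Derivation k V.functionField V.functionField))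
variable (I : V.Modules)

/-- Sections over `U` of the sheaf `P(I)` of first principal parts of `I` along the foliation:
as an abelian group this is `Γ(I, U) ⊕ Γ(IΩ, U)`, and regular functions act by
`a (s, β) = (a s, a β - s da)`. This is the usual explicit model of the extension
`0 → IΩ → P(I) → I → 0` defined by the image in `Ext¹(I, IΩ)` of the Atiyah class of `I`. -/
def PrincipalSections (U : V.Opens) : Type u := Γ(I, U) × Γ(prodSheaf I (Omega 𝓛), U)

instance (U : V.Opens) : AddCommGroup (PrincipalSections 𝓛 I U) :=
  inferInstanceAs (AddCommGroup (Γ(I, U) × Γ(prodSheaf I (Omega 𝓛), U)))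

instance (U : V.Opens) : Module Γ(V, U) (PrincipalSections 𝓛 I U) where
  smul a p := (a • p.1, a • p.2 - mulSec U p.1 (dSec 𝓛 U a))
  one_smul p := Prod.ext (one_smul _ p.1) <| by
    change (1 : Γ(V, U)) • p.2 - mulSec U p.1 (dSec 𝓛 U 1) = p.2
    rw [dSec_one, map_zero, sub_zero, one_smul]
  mul_smul a b p := Prod.ext (mul_smul a b p.1) <| by
    change (a * b) • p.2 - mulSec U p.1 (dSec 𝓛 U (a * b)) =
      a • (b • p.2 - mulSec U p.1 (dSec 𝓛 U b)) - mulSec U (b • p.1) (dSec 𝓛 U a)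
    rw [dSec_mul, map_add, map_smul, map_smul, map_smul, LinearMap.smul_apply, smul_sub, mul_smul]
    abel
  smul_zero a := Prod.ext (smul_zero a) <| by
    change a • (0 : Γ(prodSheaf I (Omega 𝓛), U)) - mulSec U (0 : Γ(I, U)) (dSec 𝓛 U a) = 0
    rw [smul_zero, map_zero, LinearMap.zero_apply, sub_zero]
  smul_add a p q := Prod.ext (smul_add a p.1 q.1) <| by
    change a • (p.2 + q.2) - mulSec U (p.1 + q.1) (dSec 𝓛 U a) =
      (a • p.2 - mulSec U p.1 (dSec 𝓛 U a)) + (a • q.2 - mulSec U q.1 (dSec 𝓛 U a))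
    rw [smul_add, map_add, LinearMap.add_apply]
    abel
  add_smul a b p := Prod.ext (add_smul a b p.1) <| by
    change (a + b) • p.2 - mulSec U p.1 (dSec 𝓛 U (a + b)) =
      (a • p.2 - mulSec U p.1 (dSec 𝓛 U a)) + (b • p.2 - mulSec U p.1 (dSec 𝓛 U b))
    rw [add_smul, dSec_add, map_add]
    abel
  zero_smul p := Prod.ext (zero_smul _ p.1) <| by
    have h : dSec 𝓛 U 0 = 0 := by
      have h := dSec_add 𝓛 U 0 0
      rw [add_zero] at h
      exact left_eq_add.mp h
    change (0 : Γ(V, U)) • p.2 - mulSec U p.1 (dSec 𝓛 U 0) = 0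
    rw [h, map_zero, zero_smul, sub_zero]

/-- The presheaf of abelian groups underlying `P(I)`. -/
def principalPresheaf : TopCat.Presheaf Ab V where
  obj U := AddCommGrpCat.of (PrincipalSections 𝓛 I U.unop)
  map i := AddCommGrpCat.ofHom
    ((I.presheaf.map i).hom.prodMap ((prodSheaf I (Omega 𝓛)).presheaf.map i).hom)
  map_id U := by
    ext p
    exact Prod.ext (congr($(I.presheaf.map_id U) p.1))
      (congr($((prodSheaf I (Omega 𝓛)).presheaf.map_id U) p.2))
  map_comp i j := by
    ext p
    exact Prod.ext (congr($(I.presheaf.map_comp i j) p.1))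
      (congr($((prodSheaf I (Omega 𝓛)).presheaf.map_comp i j) p.2))

theorem principalPresheaf_isSheaf : (principalPresheaf 𝓛 I).IsSheaf := by
  rw [TopCat.Presheaf.isSheaf_iff_isSheafUniqueGluing]
  intro ι U sf h
  obtain ⟨s, hs, hs'⟩ := I.isSheaf.isSheafUniqueGluing U (fun i => (sf i).1)
    fun i j => congrArg Prod.fst (h i j)
  obtain ⟨t, ht, ht'⟩ := (prodSheaf I (Omega 𝓛)).isSheaf.isSheafUniqueGluing U
    (fun i => (sf i).2) fun i j => congrArg Prod.snd (h i j)
  exact ⟨(s, t), fun i => Prod.ext (hs i) (ht i), fun p hp =>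
    Prod.ext (hs' _ fun i => congrArg Prod.fst (hp i)) (ht' _ fun i => congrArg Prod.snd (hp i))⟩

/-- The sheaf `P(I)` of first principal parts of `I` along the foliation. -/
def principalParts : V.Modules where
  val :=
    letI : ∀ U : V.Opensᵒᵖ, Module (V.ringCatSheaf.obj.obj U) ((principalPresheaf 𝓛 I).obj U) :=
      fun U => inferInstanceAs (Module Γ(V, U.unop) (PrincipalSections 𝓛 I U.unop))
    PresheafOfModules.ofPresheaf (principalPresheaf 𝓛 I) (fun U U' i a p =>
      Prod.ext (I.map_smul i.unop a p.1) <| by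
        let b : Γ(V, U.unop) := a
        let b' : Γ(V, U'.unop) := V.presheaf.map i b
        let q : Γ(prodSheaf I (Omega 𝓛), U'.unop) := (prodSheaf I (Omega 𝓛)).presheaf.map i p.2
        change (prodSheaf I (Omega 𝓛)).presheaf.map i (b • p.2 - mulSec U.unop p.1 (dSec 𝓛 U.unop b))
          = b' • q - mulSec U'.unop (I.presheaf.map i p.1) (dSec 𝓛 U'.unop b')
        rw [map_sub]
        congr 1
        · exact (prodSheaf I (Omega 𝓛)).map_smul i.unop b p.2
        · refine (mulSec_res i.unop p.1 (dSec 𝓛 U.unop b)).trans ?_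
          rw [dSec_res]
          rfl)
  isSheaf := principalPresheaf_isSheaf 𝓛 I

variable {I}

/-- The principal part of a section `f` of `I`. For `I` inside the function field and a basis
`δ₁, …, δᵣ` of `𝓛` it corresponds to the row `(f, δ₁ f, …, δᵣ f)`. -/
def jet (U : V.Opens) (f : Γ(I, U)) : Γ(principalParts 𝓛 I, U) :=
  ((f, 0) : PrincipalSections 𝓛 I U)

/-- Functoriality of `P`. -/
def principalMap {I' : V.Modules} (φ : I ⟶ I') : principalParts 𝓛 I ⟶ principalParts 𝓛 I' :=
  ⟨PresheafOfModules.homMk (M₁ := (principalParts 𝓛 I).val) (M₂ := (principalParts 𝓛 I').val)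
    { app := fun U => AddCommGrpCat.ofHom ((φ.app U.unop).hom.prodMap
        ((prodMap φ (𝟙 (Omega 𝓛))).app U.unop).hom)
      naturality := fun U U' i => by
        ext p
        exact Prod.ext (congr($(φ.mapPresheaf.naturality i) p.1))
          (congr($((prodMap φ (𝟙 (Omega 𝓛))).mapPresheaf.naturality i) p.2)) }
    (fun U a p => Prod.ext (φ.app_smul a p.1) <| by
      let b : Γ(V, U.unop) := a
      change (prodMap φ (𝟙 (Omega 𝓛))).app U.unop
          (b • p.2 - mulSec U.unop p.1 (dSec 𝓛 U.unop b)) =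
        b • (prodMap φ (𝟙 (Omega 𝓛))).app U.unop p.2 -
          mulSec U.unop (φ.app U.unop p.1) (dSec 𝓛 U.unop b)
      rw [map_sub, prodMap_mulSec]
      congr 1
      exact (prodMap φ (𝟙 (Omega 𝓛))).app_smul b p.2)⟩

end principal

section algebra

variable {k : Type u} [Field k] [V.Over (Spec (.of k))]
variable (𝓛 : Submodule V.functionField (Derivation k V.functionField V.functionField))

/-- The dimension `r` of `𝓛` over the function field. -/
abbrev folRank : ℕ := Module.finrank V.functionField 𝓛

/-- `F(I) = Λ^{r+1} P(I) / torsion`. -/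
def FSheaf (I : V.Modules) : V.Modules := extSheaf (folRank 𝓛 + 1) (principalParts 𝓛 I)

/-- Functoriality of `F`. -/
def FMap {I I' : V.Modules} (φ : I ⟶ I') : FSheaf 𝓛 I ⟶ FSheaf 𝓛 I' :=
  extMap _ (principalMap 𝓛 φ)

/-- The section of `F(I)` given by `f₀, …, fᵣ ∈ Γ(I, U)`: the wedge product of their principal
parts. For `I` inside the function field and a basis `δ₁, …, δᵣ` of `𝓛` it corresponds to the
determinant with rows `(fᵢ, δ₁ fᵢ, …, δᵣ fᵢ)`. -/
def detSec {I : V.Modules} (U : V.Opens) (f : Fin (folRank 𝓛 + 1) → Γ(I, U)) :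
    Γ(FSheaf 𝓛 I, U) :=
  wedgeSec _ U fun i => jet 𝓛 U (f i)

/-- `J₀ = I` and `J_{s+1} = J_s F(J_s) = I L₀ L₁ ⋯ L_s`, where `L_s = F(J_s)`. -/
def JSheaf (I : V.Modules) : ℕ → V.Modules
  | 0 => I
  | s + 1 => prodSheaf (JSheaf I s) (FSheaf 𝓛 (JSheaf I s))

/-- `L_s = F(J_s)`. -/
def LSheaf (I : V.Modules) (s : ℕ) : V.Modules := FSheaf 𝓛 (JSheaf 𝓛 I s)

/-- Functoriality of `J_s`. -/
def JMap {I I' : V.Modules} (φ : I ⟶ I') : ∀ s, JSheaf 𝓛 I s ⟶ JSheaf 𝓛 I' s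
  | 0 => φ
  | s + 1 => prodMap (JMap φ s) (FMap 𝓛 (JMap φ s))

/-- Functoriality of `L_s`. -/
def LMap {I I' : V.Modules} (φ : I ⟶ I') (s : ℕ) : LSheaf 𝓛 I s ⟶ LSheaf 𝓛 I' s :=
  FMap 𝓛 (JMap 𝓛 φ s)

variable (V) in
/-- The structure sheaf `𝒪_V` as a module over itself. -/
def structureSheaf : V.Modules := SheafOfModules.unit V.ringCatSheaf

/-- The powers `A⁰ = 𝒪_V`, `A^{n+1} = Aⁿ A`. -/
def powSheaf (A : V.Modules) : ℕ → V.Modules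
  | 0 => structureSheaf V
  | n + 1 => prodSheaf (powSheaf A n) A

/-- Functoriality of powers. -/
def powMap {A A' : V.Modules} (φ : A ⟶ A') : ∀ n, powSheaf A n ⟶ powSheaf A' n
  | 0 => 𝟙 _
  | n + 1 => prodMap (powMap φ n) φ

/-- The product `x₀ x₁ ⋯ x_{n-1}` in `Aⁿ`. -/
def powSec {A : V.Modules} (U : V.Opens) (x : ℕ → Γ(A, U)) : ∀ n, Γ(powSheaf A n, U)
  | 0 => (1 : Γ(V, U))
  | n + 1 => mulSec U (powSec U x n) (x n)

/-- The product `A_s^{a₀} A_{s+1}^{a₁} ⋯` for a list of exponents `a₀, a₁, …`. -/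
def listProd (A : ℕ → V.Modules) : ℕ → List ℕ → V.Modules
  | _, [] => structureSheaf V
  | s, a :: l => prodSheaf (powSheaf (A s) a) (listProd A (s + 1) l)

/-- Functoriality of such products. -/
def listMap {A A' : ℕ → V.Modules} (φ : ∀ s, A s ⟶ A' s) :
    ∀ s l, listProd A s l ⟶ listProd A' s l
  | _, [] => 𝟙 _
  | s, a :: l => prodMap (powMap (φ s) a) (listMap φ (s + 1) l)

/-- The product of sections `x s t` (with `t` smaller than the exponent of `A_s`) in such a
product of sheaves. -/
def listSec {A : ℕ → V.Modules} (U : V.Opens) (x : ∀ s, ℕ → Γ(A s, U)) :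
    ∀ s l, Γ(listProd A s l, U)
  | _, [] => (1 : Γ(V, U))
  | s, a :: l => mulSec U (powSec U (x s) a) (listSec U x (s + 1) l)

/-- `R_i = L₀^{a₀} L₁^{a₁} ⋯` where `a₀, a₁, …` are the digits of `i` in base `r + 2`. -/
def RSheaf (I : V.Modules) (i : ℕ) : V.Modules :=
  listProd (LSheaf 𝓛 I) 0 (Nat.digits (folRank 𝓛 + 2) i)

theorem RSheaf_zero (I : V.Modules) : RSheaf 𝓛 I 0 = structureSheaf V := rfl

/-- Functoriality of `R_i`. -/
def RMap {I I' : V.Modules} (φ : I ⟶ I') (i : ℕ) : RSheaf 𝓛 I i ⟶ RSheaf 𝓛 I' i :=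
  listMap (LMap 𝓛 φ) 0 _

/-- The section `∏_s ∏_{t < a_s} x s t` of `R_i = L₀^{a₀} L₁^{a₁} ⋯`. -/
def monomial {I : V.Modules} (U : V.Opens) (i : ℕ) (x : ∀ s, ℕ → Γ(LSheaf 𝓛 I s, U)) :
    Γ(RSheaf 𝓛 I i, U) :=
  listSec U x 0 _

/-- A section of `L_s`, seen as a section of `R_{(r+2)^s}` (whose only nonzero digit is a `1` in
place `s`). -/
def ofL {I : V.Modules} (U : V.Opens) (s : ℕ) (y : Γ(LSheaf 𝓛 I s, U)) :
    Γ(RSheaf 𝓛 I ((folRank 𝓛 + 2) ^ s), U) :=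
  monomial 𝓛 U _ (Pi.single s fun _ => y)

variable (V) in
/-- A coherent torsion free sheaf of rank one. (On a variety, which is locally Noetherian,
coherent means quasi-coherent of finite type.) -/
structure TorsionFreeRankOne where
  /-- The sheaf. -/
  sheaf : V.Modules
  isQuasicoherent : sheaf.IsQuasicoherent
  isFiniteType : sheaf.IsFiniteType
  torsionFree : ∀ (U : V.Opens) (a : Γ(V, U)) (s : Γ(sheaf, U)), a • s = 0 → a = 0 ∨ s = 0
  rank_one : Module.finrank V.functionField (GenericFiber sheaf) = 1

/-- The structure of a graded sheaf of commutative `𝒪_V`-algebras on `⨁ R_i`: `𝒪_V`-linear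
multiplication maps `R_i R_j → R_{i+j}` and a unit `𝒪_V → R_0` that satisfy the ring axioms on
sections over every open set. -/
structure GradedSheafAlgebra (R : ℕ → V.Modules) where
  /-- The unit. -/
  unit : structureSheaf V ⟶ R 0
  /-- The multiplication. -/
  mul (i j : ℕ) : prodSheaf (R i) (R j) ⟶ R (i + j)
  one_mul (U : V.Opens) (i : ℕ) (x : Γ(R i, U)) :
    GradedMonoid.mk (A := fun n => Γ(R n, U)) (0 + i)
      ((mul 0 i).app U (mulSec U (unit.app U (1 : Γ(V, U))) x)) = GradedMonoid.mk i x
  mul_comm (U : V.Opens) (i j : ℕ) (x : Γ(R i, U)) (y : Γ(R j, U)) :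
    GradedMonoid.mk (A := fun n => Γ(R n, U)) (i + j) ((mul i j).app U (mulSec U x y)) =
      GradedMonoid.mk (j + i) ((mul j i).app U (mulSec U y x))
  mul_assoc (U : V.Opens) (i j l : ℕ) (x : Γ(R i, U)) (y : Γ(R j, U)) (z : Γ(R l, U)) :
    GradedMonoid.mk (A := fun n => Γ(R n, U)) (i + j + l)
        ((mul (i + j) l).app U (mulSec U ((mul i j).app U (mulSec U x y)) z)) =
      GradedMonoid.mk (i + (j + l))
        ((mul i (j + l)).app U (mulSec U x ((mul j l).app U (mulSec U y z))))

/-- The commutative ring structure on `⨁ Γ(R_i, U)`. -/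
abbrev GradedSheafAlgebra.gcommRing {R : ℕ → V.Modules} (𝒜 : GradedSheafAlgebra R) (U : V.Opens) :
    DirectSum.GCommRing (fun i => Γ(R i, U)) :=
  letI mon : GradedMonoid.GMul (fun i => Γ(R i, U)) :=
    ⟨fun {i j} x y => (𝒜.mul i j).app U (mulSec U x y)⟩
  letI one : GradedMonoid.GOne (fun i => Γ(R i, U)) := ⟨𝒜.unit.app U (1 : Γ(V, U))⟩
  { mul := fun {i j} x y => (𝒜.mul i j).app U (mulSec U x y)
    one := 𝒜.unit.app U (1 : Γ(V, U))
    mul_zero := fun x => by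
      change (𝒜.mul _ _).app U (mulSec U x 0) = 0
      rw [map_zero, map_zero]
    zero_mul := fun y => by
      change (𝒜.mul _ _).app U (mulSec U 0 y) = 0
      rw [map_zero, LinearMap.zero_apply, map_zero]
    mul_add := fun x y z => by
      change (𝒜.mul _ _).app U (mulSec U x (y + z)) = _
      rw [map_add, map_add]
    add_mul := fun x y z => by
      change (𝒜.mul _ _).app U (mulSec U (x + y) z) = _
      rw [map_add, LinearMap.add_apply, map_add]
    one_mul := fun x => 𝒜.one_mul U x.1 x.2
    mul_one := fun x => (𝒜.mul_comm U _ _ _ _).trans (𝒜.one_mul U x.1 x.2)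
    mul_assoc := fun x y z => 𝒜.mul_assoc U _ _ _ x.2 y.2 z.2
    mul_comm := fun x y => 𝒜.mul_comm U _ _ x.2 y.2
    natCast := fun n => n • 𝒜.unit.app U (1 : Γ(V, U))
    natCast_zero := zero_smul _ _
    natCast_succ := fun n => succ_nsmul _ n
    intCast := fun n => n • 𝒜.unit.app U (1 : Γ(V, U))
    intCast_ofNat := fun n => natCast_zsmul _ n
    intCast_negSucc_ofNat := fun n => negSucc_zsmul _ n }

section identities

variable {𝓛}
variable {I : V.Modules} {s : ℕ}

/-- The determinant-power identity: for `h` the determinant given by `f₀, …, fᵣ ∈ J_s`, the map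
sends `h^{r+2}` to the determinant given by `h f₀, …, h fᵣ ∈ J_{s+1}`. -/
def DetPower (ν : powSheaf (LSheaf 𝓛 I s) (folRank 𝓛 + 2) ⟶ LSheaf 𝓛 I (s + 1)) : Prop :=
  ∀ (U : V.Opens) (f : Fin (folRank 𝓛 + 1) → Γ(JSheaf 𝓛 I s, U)),
    ν.app U (powSec U (fun _ => detSec 𝓛 U f) (folRank 𝓛 + 2)) =
      detSec 𝓛 (I := JSheaf 𝓛 I (s + 1)) U fun i => mulSec U (f i) (detSec 𝓛 U f)

/-- The determinant-power identity for all sections `h` of `L_s`: with `w` the determinant given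
by `f₀, …, fᵣ ∈ J_s`, the map sends `h^{r+1} w` to the determinant given by `h f₀, …, h fᵣ`. -/
def StrongDetPower (ν : powSheaf (LSheaf 𝓛 I s) (folRank 𝓛 + 2) ⟶ LSheaf 𝓛 I (s + 1)) : Prop :=
  ∀ (U : V.Opens) (f : Fin (folRank 𝓛 + 1) → Γ(JSheaf 𝓛 I s, U)) (h : Γ(LSheaf 𝓛 I s, U)),
    ν.app U (mulSec U (powSec U (fun _ => h) (folRank 𝓛 + 1)) (detSec 𝓛 U f)) =
      detSec 𝓛 (I := JSheaf 𝓛 I (s + 1)) U fun i => mulSec U (f i) h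

/-- The multiplication of `R` is the one defined by carrying in base `r + 2` along maps
`ν_s : L_s^{r+2} → L_{s+1}`. -/
structure IsCarrying
    (ν : ∀ s, powSheaf (LSheaf 𝓛 I s) (folRank 𝓛 + 2) ⟶ LSheaf 𝓛 I (s + 1))
    (𝒜 : GradedSheafAlgebra (RSheaf 𝓛 I)) : Prop where
  /-- Without carrying, the multiplication is the tautological one: a product of sections of the
  `L_s` in `R_i = L₀^{a₀} L₁^{a₁} ⋯` is also their product in the algebra. -/
  monomial_eq (U : V.Opens) (i : ℕ) (x : ∀ s, ℕ → Γ(LSheaf 𝓛 I s, U)) :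
    letI := 𝒜.gcommRing U
    DirectSum.of (fun n => Γ(RSheaf 𝓛 I n, U)) i (monomial 𝓛 U i x) =
      ∏ s ∈ Finset.range (Nat.digits (folRank 𝓛 + 2) i).length,
        ∏ t ∈ Finset.range ((Nat.digits (folRank 𝓛 + 2) i).getD s 0),
          DirectSum.of (fun n => Γ(RSheaf 𝓛 I n, U)) ((folRank 𝓛 + 2) ^ s) (ofL 𝓛 U s (x s t))
  /-- Carrying: `r + 2` factors from `L_s` are replaced by one factor from `L_{s+1}`. -/
  carry (U : V.Opens) (s : ℕ) (y : ℕ → Γ(LSheaf 𝓛 I s, U)) :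
    letI := 𝒜.gcommRing U
    ∏ t ∈ Finset.range (folRank 𝓛 + 2),
        DirectSum.of (fun n => Γ(RSheaf 𝓛 I n, U)) ((folRank 𝓛 + 2) ^ s) (ofL 𝓛 U s (y t)) =
      DirectSum.of (fun n => Γ(RSheaf 𝓛 I n, U)) ((folRank 𝓛 + 2) ^ (s + 1))
        (ofL 𝓛 U (s + 1) ((ν s).app U (powSec U y (folRank 𝓛 + 2))))

end identities

end algebra

end Foliation

end

open Foliation

/-!
The whole construction takes place inside the function field `K`. A coordinate on a sheaf `M` is a
`K`-linear isomorphism `τ` from its generic fibre to `K`. It turns the stalks of `M` into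
`𝒪_{V,x}`-submodules of `K` (`frac τ x`), the fractional ideals of `M`. For sheaves that embed into
their generic fibre, inclusions of fractional ideals are the same as morphisms that become the
identity of `K` in the coordinates (`coordHom`), and a morphism is determined by the image of one
nonzero section (`EmbedsInFiber.hom_ext_of_section`). The product `AB` gets the product of the
coordinates, and its fractional ideals are the products of those of `A` and `B` (`frac_prodCoord`).

A coordinate `c` on `J` identifies the generic fibre of `P(J)` with a subspace of `K ⊕ 𝓛^∨` by
`(s, β) ↦ (c s, d(c s) + c β)`. This space has dimension `r + 1`, the module of derivations of `K`
being finite-dimensional, so that the determinant is a coordinate on `F(J)` (`FCoord`). It sends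
`w(f₀, …, fᵣ)` to a generalized Wronskian of the `c fᵢ`. The stalks of `P(J)` are spanned by
principal parts of sections of `J`, hence the fractional ideals of `F(J)` are spanned by Wronskians
(`frac_FCoord`).

The key identity is that the Wronskian of `u a₀, …, u aᵣ` is `u^{r+1}` times that of the `aᵢ`
(`wronskian_mul`). With the coordinates on `J_s` and `L_s` obtained from one on `I`, it says that
`w(h f₀, …, h fᵣ)` has coordinate `h^{r+1} w(f₀, …, fᵣ)`. So `ν_s` has to be the multiplication of
`K`, and it exists because `L_s^{r+2} ⊆ L_{s+1}` inside `K` (`frac_LCoord_pow_le`): the elements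
`h^{r+1} w(f)` span `L_s^{r+2}` by polarization, which is where characteristic zero is used.

The multiplication of `⨁ R_i` is again that of `K`. The inclusions `R_i R_j ⊆ R_{i+j}` follow from
`L_s^{r+2} ⊆ L_{s+1}` by carrying (`digitProd_mul_le`), and associativity and commutativity are
inherited from `K`. Uniqueness and naturality are tested on a nonzero section `y₀` of `L₀` and the
sections `y_{s+1} = ν_s(y_s^{r+2})`: in every algebra defined by carrying, the monomial of degree
`i` in the `y_s` is the power `y₀ⁱ` (`IsCarrying.of_monomial_eq_pow`).
-/

noncomputable section

namespace Foliation

variable {V : Scheme.{u}} [AlgebraicGeometry.IsIntegral V]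

/-! ### Stalks, the generic fibre, and morphisms of sheaves -/

section fibre

variable {M N : V.Modules}

theorem exists_res_eq {U U' : V.Opens} {x y : V} (hx : x ∈ U) (hy : y ∈ U') (s : Γ(M, U))
    (t : Γ(M, U')) (h : gen hx s = gen hy t) :
    ∃ (O : V.Opens) (_ : genericPoint V ∈ O) (i : O ⟶ U) (j : O ⟶ U'),
      M.presheaf.map i.op s = M.presheaf.map j.op t :=
  M.presheaf.germ_eq _ (generic_mem hx) (generic_mem hy) s t h

/-- Finitely many elements of a stalk come from sections over a common neighbourhood. -/
theorem exists_common_section {ι : Type*} [Finite ι] {x : V} {m : ι → GenericFiber M}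
    (hm : ∀ i, m i ∈ stalkImage M x) :
    ∃ (U : V.Opens) (hx : x ∈ U) (s : ι → Γ(M, U)), ∀ i, gen hx (s i) = m i := by
  choose U hU s hs using hm
  have : Fintype ι := Fintype.ofFinite ι
  let O : V.Opens := ⟨⋂ i, U i, isOpen_iInter_of_finite fun i => (U i).isOpen⟩
  have hO : ∀ i, O ≤ U i := fun i y hy => Set.mem_iInter.1 hy i
  have hxO : x ∈ O := Set.mem_iInter.2 hU
  exact ⟨O, hxO, fun i => M.presheaf.map (homOfLE (hO i)).op (s i), fun i => by
    rw [gen_res, ← hs i]⟩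

theorem stalkImage_generic (m : GenericFiber M) : m ∈ stalkImage M (genericPoint V) :=
  exists_gen m

theorem add_mem_stalkImage {x : V} {m m' : GenericFiber M} (hm : m ∈ stalkImage M x)
    (hm' : m' ∈ stalkImage M x) : m + m' ∈ stalkImage M x := by
  obtain ⟨U, hx, s, hs⟩ := exists_common_section (m := ![m, m'])
    (Fin.forall_fin_two.2 ⟨hm, hm'⟩)
  exact ⟨U, hx, s 0 + s 1, by rw [map_add, hs, hs]; rfl⟩

theorem zero_mem_stalkImage (x : V) : (0 : GenericFiber M) ∈ stalkImage M x :=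
  ⟨⊤, trivial, 0, map_zero _⟩

theorem exists_toRat_of_mem {x : V} {a : V.functionField} (ha : a ∈ localRing x) :
    ∃ (U : V.Opens) (hx : x ∈ U) (b : Γ(V, U)), toRat hx b = a := by
  obtain ⟨a, rfl⟩ := ha
  obtain ⟨U, hx, b, rfl⟩ := V.presheaf.exists_germ_eq a
  have : Nonempty U := ⟨⟨x, hx⟩⟩
  exact ⟨U, hx, b, (V.algebraMap_germ_eq_germToFunctionField hx b).symm⟩

theorem smul_mem_stalkImage {x : V} {a : V.functionField} (ha : a ∈ localRing x)
    {m : GenericFiber M} (hm : m ∈ stalkImage M x) : a • m ∈ stalkImage M x := by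
  obtain ⟨U, hx, s, rfl⟩ := hm
  obtain ⟨U', hx', b, rfl⟩ := exists_toRat_of_mem ha
  have h : x ∈ U ⊓ U' := ⟨hx, hx'⟩
  refine ⟨U ⊓ U', h, V.presheaf.map (Opens.infLERight U U').op b •
    M.presheaf.map (Opens.infLELeft U U').op s, ?_⟩
  rw [gen_smul, gen_res, toRat_res]

/-- A linear map out of the generic fibre, given on sections over the nonempty open sets. -/
def fiberLift {W : Type*} [AddCommGroup W] [Module V.functionField W]
    (F : ∀ (U : V.Opens), genericPoint V ∈ U → Γ(M, U) →+ W)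
    (hres : ∀ (U U' : V.Opens) (i : U' ⟶ U) (h : genericPoint V ∈ U') (s : Γ(M, U)),
      F U' h (M.presheaf.map i.op s) = F U (i.le h) s)
    (hsmul : ∀ (U : V.Opens) (h : genericPoint V ∈ U) (a : Γ(V, U)) (s : Γ(M, U)),
      F U h (a • s) = toRat h a • F U h s) :
    {g : GenericFiber M →ₗ[V.functionField] W //
      ∀ (U : V.Opens) (h : genericPoint V ∈ U) (s : Γ(M, U)), g (gen h s) = F U h s} :=
  letI g (m : GenericFiber M) : W :=
    F _ (exists_gen m).choose_spec.choose (exists_gen m).choose_spec.choose_spec.choose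
  have hg (U : V.Opens) (h : genericPoint V ∈ U) (s : Γ(M, U)) : g (gen h s) = F U h s := by
    obtain ⟨O, hO, i, j, e⟩ := exists_res_eq _ _ _ _
      (exists_gen (gen h s)).choose_spec.choose_spec.choose_spec
    have := congrArg (F O hO) e
    rwa [hres, hres] at this
  ⟨{ toFun := g
     map_add' := fun m m' => by
      obtain ⟨U, hx, s, hs⟩ := exists_common_section (x := genericPoint V) (m := ![m, m'])
        (fun i => stalkImage_generic _)
      have h0 : m = gen hx (s 0) := (hs 0).symm
      have h1 : m' = gen hx (s 1) := (hs 1).symm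
      rw [h0, h1, ← map_add, hg, hg, hg, map_add]
     map_smul' := fun a m => by
      obtain ⟨U, hU, s, rfl⟩ := exists_gen m
      obtain ⟨U', hU', b, rfl⟩ := exists_toRat a
      have h : genericPoint V ∈ U ⊓ U' := ⟨hU, hU'⟩
      have e : gen hU s = gen h (M.presheaf.map (Opens.infLELeft U U').op s) := by rw [gen_res]
      have e' : toRat hU' b = toRat h (V.presheaf.map (Opens.infLERight U U').op b) := by
        rw [toRat_res]
      rw [e, e', ← gen_smul, hg, hg, hsmul]
      rfl }, hg⟩

/-- A sheaf of modules without torsion in the following sense: it embeds into the constant sheaf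
given by its generic fibre. -/
def EmbedsInFiber (M : V.Modules) : Prop :=
  ∀ (U : V.Opens) (s : Γ(M, U)), (∀ x (hx : x ∈ U), gen hx s = 0) → s = 0

theorem EmbedsInFiber.ext (hM : EmbedsInFiber M) {U : V.Opens} {s t : Γ(M, U)}
    (h : ∀ x (hx : x ∈ U), gen hx s = gen hx t) : s = t :=
  sub_eq_zero.1 <| hM U _ fun x hx => by rw [map_sub, h x hx, sub_self]

/-- An element of the generic fibre that lies in the stalks at all points of `U` is a section
over `U`. -/
theorem EmbedsInFiber.glue (hM : EmbedsInFiber M) {U : V.Opens}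
    (m : ∀ x ∈ U, GenericFiber M) (hm : ∀ x hx y hy, m x hx = m y hy)
    (h : ∀ x hx, m x hx ∈ stalkImage M x) :
    ∃ t : Γ(M, U), ∀ x (hx : x ∈ U), gen hx t = m x hx := by
  choose O hO t ht using fun x : U => h x.1 x.2
  let O' : U → V.Opens := fun x => O x ⊓ U
  let t' : ∀ x, Γ(M, O' x) := fun x => M.presheaf.map (Opens.infLELeft (O x) U).op (t x)
  have ht' : ∀ (x : U) y (hy : y ∈ O' x), gen hy (t' x) = m y hy.2 := fun x y hy => by
    rw [gen_res, hm y hy.2 x.1 x.2, ← ht x]; rfl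
  obtain ⟨g, hg, -⟩ := TopCat.Sheaf.existsUnique_gluing' ⟨M.presheaf, M.isSheaf⟩ O' U
    (fun x => Opens.infLERight (O x) U) (fun x hx => Opens.mem_iSup.2 ⟨⟨x, hx⟩, hO ⟨x, hx⟩, hx⟩) t'
    (fun x y => hM.ext fun z hz => by
      refine (gen_res _ hz (t' x)).trans (.trans ?_ (gen_res _ hz (t' y)).symm)
      rw [ht' x z hz.1, ht' y z hz.2])
  refine ⟨g, fun x hx => ?_⟩
  have hx' : x ∈ O' ⟨x, hx⟩ := ⟨hO ⟨x, hx⟩, hx⟩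
  rw [← ht' ⟨x, hx⟩ x hx', ← hg, gen_res]

/-- A linear map of generic fibres that respects the stalks is induced by a morphism of
sheaves. -/
theorem EmbedsInFiber.exists_hom (hN : EmbedsInFiber N)
    (g : GenericFiber M →ₗ[V.functionField] GenericFiber N)
    (hg : ∀ x, ∀ m ∈ stalkImage M x, g m ∈ stalkImage N x) :
    ∃ φ : M ⟶ N, genericMap φ = g := by
  have key (U : V.Opens) (s : Γ(M, U)) :
      ∃ t : Γ(N, U), ∀ x (hx : x ∈ U), gen hx t = g (gen hx s) :=
    hN.glue (fun x hx => g (gen hx s)) (fun _ _ _ _ => rfl) fun x hx => hg x _ ⟨U, hx, s, rfl⟩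
  choose F hF using key
  let φ : M ⟶ N := ⟨PresheafOfModules.homMk (M₁ := M.val) (M₂ := N.val)
    { app := fun U => AddCommGrpCat.ofHom
        (X := Γ(M, U.unop)) (Y := Γ(N, U.unop))
        { toFun := F U.unop
          map_zero' := hN.ext fun x hx => by simp [hF]
          map_add' := fun s t => hN.ext fun x hx => by simp [hF] }
      naturality := fun U U' i => by
        ext s
        refine hN.ext fun x hx => ?_
        refine (hF U'.unop (M.presheaf.map i s) x hx).trans
          (.trans ?_ (gen_res i.unop hx (F U.unop s)).symm)
        refine (congrArg g ?_).trans (hF U.unop s x (i.unop.le hx)).symm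
        exact gen_res i.unop hx s }
    (fun U a s => hN.ext (U := U.unop) fun x hx => by
      let b : Γ(V, U.unop) := a
      let s' : Γ(M, U.unop) := s
      change gen hx (F U.unop (b • s')) = gen hx (b • F U.unop s')
      rw [hF, gen_smul, gen_smul, hF, map_smul])⟩
  refine ⟨φ, LinearMap.ext fun m => ?_⟩
  obtain ⟨U, hU, s, rfl⟩ := exists_gen m
  rw [genericMap_gen]
  exact hF U s _ hU

theorem EmbedsInFiber.hom_ext (hN : EmbedsInFiber N) {φ ψ : M ⟶ N}
    (h : genericMap φ = genericMap ψ) : φ = ψ := by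
  ext U s
  exact hN.ext fun x hx => by rw [← genericMap_gen, h, genericMap_gen]

end fibre

/-! ### The generic fibre of a lattice sheaf -/

section lattice

variable {W : Type u} [AddCommGroup W] [Module V.functionField W]
variable (N : ∀ x : V, Submodule (localRing x) W)

variable {N} in
/-- The value at a point of a section of a lattice sheaf. -/
def latticeValue {U : V.Opens} (s : Γ(latticeSheaf W N, U)) (x : U) : W :=
  (show latticeSections W N U from s).1 x

/-- The generic fibre of a subsheaf of the constant sheaf `W` is a subspace of `W`. -/
def latticeFiber : GenericFiber (latticeSheaf W N) →ₗ[V.functionField] W :=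
  (fiberLift (M := latticeSheaf W N)
    (fun _ h => { toFun := fun s : latticeSections W N _ => s.1 ⟨_, h⟩
                  map_zero' := rfl
                  map_add' := fun _ _ => rfl })
    (fun _ _ _ _ _ => rfl) (fun _ _ _ _ => rfl)).1

theorem latticeFiber_gen {U : V.Opens} {x : V} (hx : x ∈ U) (s : Γ(latticeSheaf W N, U)) :
    latticeFiber N (gen hx s) = latticeValue s ⟨x, hx⟩ := by
  refine ((fiberLift (M := latticeSheaf W N) _ _ _).2 U (generic_mem hx) s).trans ?_
  -- A locally constant function on an open subset of an irreducible space is constant.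
  obtain ⟨O, hO, hxO, h⟩ := (IsLocallyConstant.iff_exists_open _).1
    (show latticeSections W N U from s).2.1 ⟨x, hx⟩
  have e := (Opens.isOpenEmbedding' U).isOpenMap O hO
  have : genericPoint V ∈ (⟨_, e⟩ : V.Opens) := generic_mem ⟨⟨x, hx⟩, hxO, rfl⟩
  obtain ⟨y, hy, h'⟩ := this
  have hy' : y = ⟨genericPoint V, generic_mem hx⟩ := Subtype.ext h'
  exact h _ (hy' ▸ hy)

theorem latticeFiber_injective : Function.Injective (latticeFiber N) := by
  rw [injective_iff_map_eq_zero]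
  intro m hm
  obtain ⟨U, hU, s, rfl⟩ := exists_gen m
  obtain ⟨O, hO, hηO, h⟩ := (IsLocallyConstant.iff_exists_open _).1
    (show latticeSections W N U from s).2.1 ⟨_, hU⟩
  let O' : V.Opens := ⟨_, (Opens.isOpenEmbedding' U).isOpenMap O hO⟩
  have hO' : O' ≤ U := by rintro _ ⟨y, -, rfl⟩; exact y.2
  have hη : genericPoint V ∈ O' := ⟨⟨_, hU⟩, hηO, rfl⟩
  have : (latticeSheaf W N).presheaf.map (homOfLE hO').op s = 0 := by
    refine Subtype.ext (funext fun y => ?_)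
    obtain ⟨_, z, hz, rfl⟩ := y
    exact (h z hz).trans ((latticeFiber_gen N hU s).symm.trans hm)
  rw [← gen_res (homOfLE hO') hη, this, map_zero]

theorem embedsInFiber_latticeSheaf : EmbedsInFiber (latticeSheaf W N) := fun U s h =>
  Subtype.ext <| funext fun x => by
    have := congrArg (latticeFiber N) (h x.1 x.2)
    rwa [latticeFiber_gen, map_zero] at this

variable {N}

theorem latticeFiber_mem {x : V} {m : GenericFiber (latticeSheaf W N)}
    (hm : m ∈ stalkImage (latticeSheaf W N) x) : latticeFiber N m ∈ N x := by
  obtain ⟨U, hx, s, rfl⟩ := hm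
  rw [latticeFiber_gen]
  exact (show latticeSections W N U from s).2.2 ⟨x, hx⟩

/-- The stalk of a lattice sheaf whose prescribed stalk at `x` is spanned by values of sections
is the prescribed one. -/
theorem latticeFiber_image_stalkImage {x : V} {S : Set W} (hx : N x = Submodule.span _ S)
    (hS : ∀ w ∈ S, ∃ m ∈ stalkImage (latticeSheaf W N) x, latticeFiber N m = w) :
    latticeFiber N '' stalkImage (latticeSheaf W N) x = N x := by
  refine Set.Subset.antisymm (Set.image_subset_iff.2 fun m hm => latticeFiber_mem hm) fun w hw => ?_
  rw [SetLike.mem_coe, hx] at hw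
  induction hw using Submodule.span_induction with
  | mem w h => exact hS w h
  | zero => exact ⟨0, zero_mem_stalkImage x, map_zero _⟩
  | add _ _ _ _ h h' =>
    obtain ⟨m, hm, rfl⟩ := h
    obtain ⟨m', hm', rfl⟩ := h'
    exact ⟨m + m', add_mem_stalkImage hm hm', map_add _ _ _⟩
  | smul a _ _ h =>
    obtain ⟨m, hm, rfl⟩ := h
    exact ⟨a.1 • m, smul_mem_stalkImage a.2 hm, map_smul _ _ _⟩

end lattice

/-! ### Coordinates and fractional ideals -/

section coordinate

variable {M N : V.Modules}

/-- The fractional ideals attached to a sheaf `M` of rank one and a coordinate `τ` on its generic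
fibre: the image of the stalk `M_x` in the function field. -/
def frac (τ : GenericFiber M ≃ₗ[V.functionField] V.functionField) (x : V) :
    Submodule (localRing x) V.functionField where
  carrier := τ '' stalkImage M x
  zero_mem' := ⟨0, zero_mem_stalkImage x, map_zero τ⟩
  add_mem' := by
    rintro _ _ ⟨m, hm, rfl⟩ ⟨m', hm', rfl⟩
    exact ⟨m + m', add_mem_stalkImage hm hm', map_add τ m m'⟩
  smul_mem' := by
    rintro a _ ⟨m, hm, rfl⟩
    exact ⟨a.1 • m, smul_mem_stalkImage a.2 hm, map_smul τ _ _⟩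

theorem mem_frac {τ : GenericFiber M ≃ₗ[V.functionField] V.functionField} {x : V}
    {a : V.functionField} : a ∈ frac τ x ↔ ∃ m ∈ stalkImage M x, τ m = a :=
  Iff.rfl

theorem gen_mem_frac (τ : GenericFiber M ≃ₗ[V.functionField] V.functionField) {U : V.Opens}
    {x : V} (hx : x ∈ U) (s : Γ(M, U)) : τ (gen hx s) ∈ frac τ x :=
  ⟨_, ⟨U, hx, s, rfl⟩, rfl⟩

/-- In terms of coordinates, a morphism to a subsheaf of the function field is given by an
inclusion of fractional ideals. -/
theorem EmbedsInFiber.exists_hom_of_frac_le (hN : EmbedsInFiber N)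
    (τ : GenericFiber M ≃ₗ[V.functionField] V.functionField)
    (τ' : GenericFiber N ≃ₗ[V.functionField] V.functionField)
    (h : ∀ x, frac τ x ≤ frac τ' x) :
    ∃ φ : M ⟶ N, ∀ m, τ' (genericMap φ m) = τ m := by
  obtain ⟨φ, hφ⟩ := hN.exists_hom (τ.trans τ'.symm).toLinearMap fun x m hm => by
    obtain ⟨n, hn, e⟩ := h x ⟨m, hm, rfl⟩
    have : τ'.symm (τ m) = n := by rw [← e, τ'.symm_apply_apply]
    exact this ▸ hn
  exact ⟨φ, fun m => by rw [hφ]; exact τ'.apply_symm_apply _⟩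

/-- The morphism `M ⟶ N` that is the identity of the function field in the given coordinates. -/
def coordHom (hN : EmbedsInFiber N) (τ : GenericFiber M ≃ₗ[V.functionField] V.functionField)
    (τ' : GenericFiber N ≃ₗ[V.functionField] V.functionField)
    (h : ∀ x, frac τ x ≤ frac τ' x) : M ⟶ N :=
  (hN.exists_hom_of_frac_le τ τ' h).choose

theorem coordHom_app (hN : EmbedsInFiber N)
    (τ : GenericFiber M ≃ₗ[V.functionField] V.functionField)
    (τ' : GenericFiber N ≃ₗ[V.functionField] V.functionField)
    (h : ∀ x, frac τ x ≤ frac τ' x) {U : V.Opens} {x : V} (hx : x ∈ U) (s : Γ(M, U)) :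
    τ' (gen hx ((coordHom hN τ τ' h).app U s)) = τ (gen hx s) := by
  rw [← genericMap_gen]
  exact (hN.exists_hom_of_frac_le τ τ' h).choose_spec _

theorem EmbedsInFiber.ext_coord (hN : EmbedsInFiber N)
    (τ : GenericFiber N ≃ₗ[V.functionField] V.functionField) {U : V.Opens} {s t : Γ(N, U)}
    (h : ∀ x (hx : x ∈ U), τ (gen hx s) = τ (gen hx t)) : s = t :=
  hN.ext fun x hx => τ.injective (h x hx)

/-- A morphism out of a sheaf of rank one is determined by the image of a nonzero section. -/
theorem EmbedsInFiber.hom_ext_of_section (hN : EmbedsInFiber N)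
    (τ : GenericFiber M ≃ₗ[V.functionField] V.functionField) {φ ψ : M ⟶ N} {U : V.Opens} {x : V}
    (hx : x ∈ U) (s : Γ(M, U)) (hs : τ (gen hx s) ≠ 0) (h : φ.app U s = ψ.app U s) : φ = ψ := by
  refine hN.hom_ext (LinearMap.ext fun m => ?_)
  have : m = (τ m / τ (gen hx s)) • gen hx s := τ.injective <| by
    rw [map_smul, smul_eq_mul, div_mul_cancel₀ _ hs]
  rw [this, map_smul, map_smul, genericMap_gen, genericMap_gen, h]

/-- A coordinate on a sheaf whose generic fibre embeds into the function field. -/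
def coordOfInjective (g : GenericFiber M →ₗ[V.functionField] V.functionField)
    (hg : Function.Injective g) (h : ∃ m, g m ≠ 0) :
    GenericFiber M ≃ₗ[V.functionField] V.functionField :=
  LinearEquiv.ofBijective g ⟨hg, LinearMap.surjective fun e => by
    obtain ⟨m, hm⟩ := h
    exact hm (by rw [e]; rfl)⟩

end coordinate

/-! ### The coordinate on the structure sheaf -/

section structure_sheaf

theorem toRat_injective {U : V.Opens} {x : V} (hx : x ∈ U) : Function.Injective (toRat hx) := by
  have : Nonempty U := ⟨⟨x, hx⟩⟩
  exact V.germToFunctionField_injective U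

/-- A section of the structure sheaf, as a regular function. -/
def regular {U : V.Opens} (a : Γ(structureSheaf V, U)) : Γ(V, U) := a

/-- The generic fibre of the structure sheaf is the function field. -/
def unitFiber : {g : GenericFiber (structureSheaf V) →ₗ[V.functionField] V.functionField //
    ∀ (U : V.Opens) (h : genericPoint V ∈ U) (a : Γ(structureSheaf V, U)),
      g (gen h a) = toRat h (regular a)} :=
  fiberLift (M := structureSheaf V) (fun _ h => (toRat h).toAddMonoidHom)
    (fun _ _ i h a => toRat_res i h a) (fun _ h a b => map_mul (toRat h) a b)

theorem unitFiber_gen {U : V.Opens} {x : V} (hx : x ∈ U) (a : Γ(structureSheaf V, U)) :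
    unitFiber.1 (gen hx a) = toRat hx (regular a) :=
  unitFiber.2 U (generic_mem hx) a

/-- The tautological coordinate on the structure sheaf. -/
def unitCoord : GenericFiber (structureSheaf V) ≃ₗ[V.functionField] V.functionField :=
  coordOfInjective (unitFiber (V := V)).1
    (by
      rw [injective_iff_map_eq_zero]
      intro m hm
      obtain ⟨U, hU, s, rfl⟩ := exists_gen m
      rw [unitFiber_gen] at hm
      have h : s = 0 := (injective_iff_map_eq_zero _).1 (toRat_injective hU) _ hm
      rw [h, map_zero])
    ⟨gen (U := ⊤) (x := genericPoint V) trivial (1 : Γ(V, ⊤)),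
      (unitFiber_gen (V := V) (U := ⊤) (x := genericPoint V) trivial (1 : Γ(V, ⊤))).trans_ne <| by
        change toRat _ (1 : Γ(V, ⊤)) ≠ 0
        rw [map_one]
        exact one_ne_zero⟩

theorem unitCoord_gen {U : V.Opens} {x : V} (hx : x ∈ U) (a : Γ(structureSheaf V, U)) :
    unitCoord (gen hx a) = toRat hx (regular a) :=
  unitFiber_gen hx a

theorem unitCoord_gen_one {U : V.Opens} {x : V} (hx : x ∈ U) :
    unitCoord (gen (M := structureSheaf V) hx (1 : Γ(V, U))) = 1 :=
  (unitCoord_gen hx (1 : Γ(V, U))).trans (map_one _)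

theorem embedsInFiber_structureSheaf : EmbedsInFiber (structureSheaf V) := fun U a h => by
  rcases U.1.eq_empty_or_nonempty with hU | ⟨x, hx⟩
  · obtain rfl : U = ⊥ := Opens.ext hU
    exact Subsingleton.elim (α := Γ(V, ⊥)) a 0
  · refine (injective_iff_map_eq_zero _).1 (toRat_injective hx) (regular a) ?_
    rw [← unitCoord_gen, h x hx, map_zero]

theorem frac_unitCoord (x : V) : frac (unitCoord (V := V)) x = 1 := by
  ext a
  rw [Submodule.mem_one, mem_frac]
  constructor
  · rintro ⟨_, ⟨U, hx, s, rfl⟩, rfl⟩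
    exact ⟨⟨_, toRat_mem hx s⟩, (unitCoord_gen hx s).symm⟩
  · rintro ⟨a, rfl⟩
    obtain ⟨U, hx, b, hb⟩ := exists_toRat_of_mem a.2
    exact ⟨_, ⟨U, hx, b, rfl⟩, (unitCoord_gen hx b).trans hb⟩

end structure_sheaf

/-! ### Coordinates on products and powers -/

section product

variable {A B : V.Modules} (τ : GenericFiber A ≃ₗ[V.functionField] V.functionField)
  (τ' : GenericFiber B ≃ₗ[V.functionField] V.functionField)

/-- The generic fibre of a product of sheaves lies in the tensor product of the generic
fibres. -/
def prodFiber (A B : V.Modules) : GenericFiber (prodSheaf A B) →ₗ[V.functionField]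
    GenericFiber A ⊗[V.functionField] GenericFiber B :=
  latticeFiber _

theorem prodFiber_mulSec {U : V.Opens} {x : V} (hx : x ∈ U) (s : Γ(A, U)) (t : Γ(B, U)) :
    prodFiber A B (gen hx (mulSec U s t)) = gen hx s ⊗ₜ gen hx t :=
  latticeFiber_gen _ _ _

theorem prodFiber_image (A B : V.Modules) (x : V) :
    prodFiber A B '' stalkImage (prodSheaf A B) x = (Submodule.span (localRing x)
      {t | ∃ a ∈ stalkImage A x, ∃ b ∈ stalkImage B x, a ⊗ₜ[V.functionField] b = t} :
        Set (GenericFiber A ⊗[V.functionField] GenericFiber B)) := by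
  refine latticeFiber_image_stalkImage rfl ?_
  rintro _ ⟨_, ⟨U, hU, s, rfl⟩, _, ⟨U', hU', t, rfl⟩, rfl⟩
  have h : x ∈ U ⊓ U' := ⟨hU, hU'⟩
  refine ⟨_, ⟨U ⊓ U', h, mulSec _ (A.presheaf.map (Opens.infLELeft U U').op s)
    (B.presheaf.map (Opens.infLERight U U').op t), rfl⟩, ?_⟩
  refine (prodFiber_mulSec _ _ _).trans ?_
  rw [gen_res, gen_res]

/-- The product of two coordinates, as a linear map on the tensor product of the fibres. -/
def tensorCoord : GenericFiber A ⊗[V.functionField] GenericFiber B ≃ₗ[V.functionField]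
    V.functionField :=
  (TensorProduct.congr τ τ').trans (TensorProduct.lid _ _)

theorem tensorCoord_tmul (a : GenericFiber A) (b : GenericFiber B) :
    tensorCoord τ τ' (a ⊗ₜ b) = τ a * τ' b := by
  simp [tensorCoord]

theorem exists_section_coord_ne_zero :
    ∃ (U : V.Opens) (hU : genericPoint V ∈ U) (s : Γ(A, U)), τ (gen hU s) ≠ 0 := by
  obtain ⟨U, hU, s, hs⟩ := exists_gen (τ.symm 1)
  exact ⟨U, hU, s, by rw [hs, τ.apply_symm_apply]; exact one_ne_zero⟩

/-- The coordinate on a product of sheaves that is multiplicative on sections. -/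
def prodCoord : GenericFiber (prodSheaf A B) ≃ₗ[V.functionField] V.functionField :=
  coordOfInjective ((tensorCoord τ τ').toLinearMap ∘ₗ prodFiber A B)
    ((tensorCoord τ τ').injective.comp (latticeFiber_injective _)) <| by
      obtain ⟨U, hU, s, hs⟩ := exists_section_coord_ne_zero τ
      obtain ⟨U', hU', t, ht⟩ := exists_section_coord_ne_zero τ'
      have h : genericPoint V ∈ U ⊓ U' := ⟨hU, hU'⟩
      refine ⟨gen h (mulSec _ (A.presheaf.map (Opens.infLELeft U U').op s)
        (B.presheaf.map (Opens.infLERight U U').op t)), ?_⟩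
      rw [LinearMap.comp_apply, prodFiber_mulSec, gen_res, gen_res]
      exact (tensorCoord_tmul τ τ' _ _).trans_ne (mul_ne_zero hs ht)

theorem prodCoord_mulSec {U : V.Opens} {x : V} (hx : x ∈ U) (s : Γ(A, U)) (t : Γ(B, U)) :
    prodCoord τ τ' (gen hx (mulSec U s t)) = τ (gen hx s) * τ' (gen hx t) := by
  change tensorCoord τ τ' (prodFiber A B _) = _
  rw [prodFiber_mulSec, tensorCoord_tmul]

theorem frac_prodCoord (x : V) : frac (prodCoord τ τ') x = frac τ x * frac τ' x := by
  have h : (frac (prodCoord τ τ') x : Set V.functionField) =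
      tensorCoord τ τ' '' (prodFiber A B '' stalkImage (prodSheaf A B) x) :=
    Set.image_comp (tensorCoord τ τ') (prodFiber A B) _
  rw [prodFiber_image] at h
  let T := (tensorCoord τ τ').toLinearMap.restrictScalars (localRing x)
  apply SetLike.coe_injective
  rw [h]
  change T '' _ = _
  rw [← Submodule.map_coe, Submodule.map_span, Submodule.mul_eq_span_mul_set]
  congr 2
  ext c
  constructor
  · rintro ⟨_, ⟨a, ha, b, hb, rfl⟩, rfl⟩
    exact ⟨_, ⟨a, ha, rfl⟩, _, ⟨b, hb, rfl⟩, (tensorCoord_tmul τ τ' a b).symm⟩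
  · rintro ⟨_, ⟨a, ha, rfl⟩, _, ⟨b, hb, rfl⟩, rfl⟩
    exact ⟨_, ⟨a, ha, b, hb, rfl⟩, tensorCoord_tmul τ τ' a b⟩

/-- The coordinate on a power that is multiplicative on sections. -/
def powCoord : ∀ n, GenericFiber (powSheaf A n) ≃ₗ[V.functionField] V.functionField
  | 0 => unitCoord
  | n + 1 => prodCoord (powCoord n) τ

theorem powCoord_powSec {U : V.Opens} {x : V} (hx : x ∈ U) (s : ℕ → Γ(A, U)) (n : ℕ) :
    powCoord τ n (gen hx (powSec U s n)) = ∏ t ∈ Finset.range n, τ (gen hx (s t)) := by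
  induction n with
  | zero => exact unitCoord_gen_one hx
  | succ n ih =>
    rw [Finset.prod_range_succ, ← ih]
    exact prodCoord_mulSec _ _ hx _ _

theorem frac_powCoord (x : V) (n : ℕ) : frac (powCoord τ n) x = frac τ x ^ n := by
  induction n with
  | zero => exact (frac_unitCoord x).trans (pow_zero _).symm
  | succ n ih =>
    rw [pow_succ, ← ih]
    exact frac_prodCoord _ _ x

end product

/-! ### Products with exponents given by digits, and carrying -/

section list

/-- The product `I_s ^ a₀ * I_{s+1} ^ a₁ * ⋯` for a list of exponents `a₀, a₁, …`. -/
def digitProd {M : Type*} [CommMonoid M] (I : ℕ → M) : ℕ → List ℕ → M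
  | _, [] => 1
  | s, a :: l => I s ^ a * digitProd I (s + 1) l

theorem digitProd_digits {M : Type*} [CommMonoid M] (I : ℕ → M) (s : ℕ) {b : ℕ} (hb : 2 ≤ b)
    (n : ℕ) : digitProd I s (Nat.digits b n) =
      I s ^ (n % b) * digitProd I (s + 1) (Nat.digits b (n / b)) := by
  rcases Nat.eq_zero_or_pos n with rfl | hn
  · simp [digitProd]
  · rw [Nat.digits_def' hb hn]
    rfl

/-- If `I_s ^ b ≤ I_{s+1}`, then the products with exponents the digits in base `b` are
supermultiplicative: this is addition with carrying. -/
theorem digitProd_mul_le {M : Type*} [CommMonoid M] [Preorder M] [MulLeftMono M] {I : ℕ → M}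
    {b : ℕ} (hb : 2 ≤ b) (h : ∀ s, I s ^ b ≤ I (s + 1)) (s m n : ℕ) :
    digitProd I s (Nat.digits b m) * digitProd I s (Nat.digits b n) ≤
      digitProd I s (Nat.digits b (m + n)) := by
  induction k : m + n using Nat.strong_induction_on generalizing s m n with
  | _ k ih =>
  subst k
  rcases Nat.eq_zero_or_pos (m + n) with h0 | hpos
  · obtain ⟨rfl, rfl⟩ : m = 0 ∧ n = 0 := by omega
    simp [digitProd]
  have hm := Nat.div_add_mod m b
  have hn := Nat.div_add_mod n b
  have hmul : 2 * (m / b + n / b) ≤ b * (m / b) + b * (n / b) := by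
    rw [← mul_add]
    exact Nat.mul_le_mul_right _ hb
  have hI : digitProd I (s + 1) (Nat.digits b 1) = I (s + 1) := by
    rw [Nat.digits_of_lt b 1 one_ne_zero (by omega)]
    simp [digitProd]
  rw [digitProd_digits I s hb m, digitProd_digits I s hb n, digitProd_digits I s hb (m + n),
    mul_mul_mul_comm, ← pow_add]
  have key := ih (m / b + n / b) (by omega) (s + 1) (m / b) (n / b) rfl
  rcases Nat.lt_or_ge (m % b + n % b) b with hlt | hge
  · rw [Nat.add_div (by omega), Nat.add_mod, Nat.mod_eq_of_lt hlt, if_neg (by omega), add_zero]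
    exact mul_le_mul_right key _
  · -- The digits in place `s` produce a carry: `I_s ^ b` is replaced by one more factor `I_{s+1}`.
    have h1 := ih (m / b + n / b + 1) (by omega) (s + 1) (m / b + n / b) 1 rfl
    have h2 : (m + n) % b = m % b + n % b - b := by
      rw [Nat.add_mod, Nat.mod_eq_sub_mod hge,
        Nat.mod_eq_of_lt (by have := Nat.mod_lt m (y := b); have := Nat.mod_lt n (y := b); omega)]
    rw [Nat.add_div (by omega), if_pos hge, h2]
    obtain ⟨c, hc⟩ := Nat.exists_eq_add_of_le' hge
    rw [hc, Nat.add_sub_cancel, pow_add, mul_assoc]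
    refine mul_le_mul_right ?_ _
    refine le_trans (mul_le_mul' (h s) key) ?_
    rwa [mul_comm, ← hI]

variable {A : ℕ → V.Modules} (τ : ∀ s, GenericFiber (A s) ≃ₗ[V.functionField] V.functionField)

theorem embedsInFiber_listProd (s : ℕ) (l : List ℕ) : EmbedsInFiber (listProd A s l) :=
  match l with
  | [] => embedsInFiber_structureSheaf
  | _ :: _ => embedsInFiber_latticeSheaf _

/-- The coordinate on a product of powers that is multiplicative on sections. -/
def listCoord : ∀ s l, GenericFiber (listProd A s l) ≃ₗ[V.functionField] V.functionField
  | _, [] => unitCoord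
  | s, a :: l => prodCoord (powCoord (τ s) a) (listCoord (s + 1) l)

theorem listCoord_listSec {U : V.Opens} {x : V} (hx : x ∈ U) (y : ∀ s, ℕ → Γ(A s, U)) (s : ℕ)
    (l : List ℕ) : listCoord τ s l (gen hx (listSec U y s l)) =
      ∏ j ∈ Finset.range l.length, ∏ t ∈ Finset.range (l.getD j 0),
        τ (s + j) (gen hx (y (s + j) t)) := by
  induction l generalizing s with
  | nil => exact unitCoord_gen_one hx
  | cons a l ih =>
    have h : ∀ j, (fun t => τ (s + 1 + j) (gen hx (y (s + 1 + j) t))) =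
        fun t => τ (s + (j + 1)) (gen hx (y (s + (j + 1)) t)) := fun j => by
      rw [show s + 1 + j = s + (j + 1) by ring]
    rw [List.length_cons, Finset.prod_range_succ', mul_comm]
    refine (prodCoord_mulSec _ _ hx _ _).trans (congrArg₂ _ (powCoord_powSec _ hx _ _) ?_)
    rw [ih]
    exact Finset.prod_congr rfl fun j _ => Finset.prod_congr rfl fun t _ => congrFun (h j) t

theorem frac_listCoord (x : V) (s : ℕ) (l : List ℕ) :
    frac (listCoord τ s l) x = digitProd (fun s => frac (τ s) x) s l := by
  induction l generalizing s with
  | nil => exact frac_unitCoord x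
  | cons a l ih =>
    refine (frac_prodCoord _ _ x).trans ?_
    rw [frac_powCoord, ih, digitProd]

end list

/-! ### Polarization, and multilinear maps on spans -/

section algebra_lemmas

open PowerSeries in
/-- The polarization identity: a product of `n` elements is a linear combination of `n`-th powers
of their partial sums. It is the coefficient of `Tⁿ` in the expansion of `∏ (exp (hᵢ T) - 1)`. -/
theorem prod_eq_sum_pow_sum {K ι : Type*} [Field K] [CharZero K] [DecidableEq ι] (s : Finset ι)
    (h : ι → K) : ∏ i ∈ s, h i = ∑ t ∈ s.powerset,
      (-1) ^ t.card * ((s.card.factorial : K)⁻¹ * (∑ i ∈ s \ t, h i) ^ s.card) := by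
  let E : K → K⟦X⟧ := fun a => rescale a (exp K)
  have hE0 : E 0 = 1 := by
    simp only [E, rescale_zero_apply, ← coeff_zero_eq_constantCoeff_apply, coeff_exp]
    simp
  have hE : ∀ t : Finset ι, ∏ i ∈ t, E (h i) = E (∑ i ∈ t, h i) := fun t => by
    induction t using Finset.induction_on with
    | empty => simp [hE0]
    | insert i t hi ih =>
      rw [Finset.prod_insert hi, Finset.sum_insert hi, ih]
      exact exp_mul_exp_eq_exp_add _ _
  have hX : ∀ a, ∃ q : K⟦X⟧, E a - 1 = X * q ∧ constantCoeff q = a := fun a => by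
    obtain ⟨q, hq⟩ := X_dvd_iff.2 (show constantCoeff (E a - 1) = 0 by
      rw [← coeff_zero_eq_constantCoeff_apply, map_sub]
      simp [E, coeff_rescale])
    refine ⟨q, hq, ?_⟩
    have := congrArg (coeff 1) hq
    rw [coeff_succ_X_mul 0 q, coeff_zero_eq_constantCoeff_apply] at this
    rw [← this]
    simp [E, coeff_rescale, coeff_one]
  choose q hq hq' using hX
  have key : coeff s.card (∏ i ∈ s, (E (h i) - 1)) = ∏ i ∈ s, h i := by
    rw [Finset.prod_congr rfl fun i _ => hq (h i), Finset.prod_mul_distrib, Finset.prod_const]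
    have := coeff_X_pow_mul (∏ i ∈ s, q (h i)) s.card 0
    rw [zero_add] at this
    rw [this, coeff_zero_eq_constantCoeff_apply, map_prod]
    exact Finset.prod_congr rfl fun i _ => hq' _
  rw [← key, Finset.prod_sub, map_sum]
  refine Finset.sum_congr rfl fun t _ => ?_
  rw [Finset.prod_const_one, mul_one, hE,
    show ((-1 : K⟦X⟧) ^ t.card) = C ((-1) ^ t.card) by simp, coeff_C_mul]
  simp only [E, coeff_rescale, coeff_exp]
  congr 1
  rw [mul_comm]
  simp

/-- In characteristic zero a power of a submodule is spanned by powers of its elements. -/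
theorem pow_mul_le_of_pow_mul_mem {K : Type*} [Field K] [CharZero K] {O : Subring K}
    {B C P : Submodule O K} {n : ℕ} (hn : (n.factorial : K)⁻¹ ∈ O)
    (h : ∀ b ∈ B, ∀ c ∈ C, b ^ n * c ∈ P) : B ^ n * C ≤ P := by
  rw [Submodule.mul_le]
  intro b hb c hc
  rw [Submodule.pow_eq_span_pow_set] at hb
  induction hb using Submodule.span_induction with
  | mem b hb =>
    obtain ⟨f, rfl⟩ := Set.mem_pow.1 hb
    rw [List.prod_ofFn, prod_eq_sum_pow_sum, Finset.sum_mul]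
    refine Submodule.sum_mem _ fun t _ => ?_
    rw [Finset.card_univ, Fintype.card_fin]
    have := P.smul_mem ((-1) ^ t.card * ⟨_, hn⟩ : O)
      (h _ (Submodule.sum_mem B fun i (_ : i ∈ Finset.univ \ t) => (f i).2) c hc)
    rwa [Subring.smul_def, smul_eq_mul, Subring.coe_mul, Subring.coe_pow, Subring.coe_neg,
      Subring.coe_one, ← mul_assoc, mul_assoc ((-1) ^ t.card)] at this
  | zero => rw [zero_mul]; exact P.zero_mem
  | add _ _ _ _ h h' => rw [add_mul]; exact P.add_mem h h'
  | smul a _ _ h => rw [smul_mul_assoc]; exact P.smul_mem a h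

/-- The values of a multilinear map on the span of a set lie in the span of its values on the
set. -/
theorem MultilinearMap.map_mem_span {R ι W M : Type*} [CommRing R] [Finite ι] [AddCommGroup W]
    [Module R W] [AddCommGroup M] [Module R M] (f : MultilinearMap R (fun _ : ι => W) M)
    {S : Set W} {p : ι → W} (hp : ∀ i, p i ∈ Submodule.span R S) :
    f p ∈ Submodule.span R (f '' {q | ∀ i, q i ∈ S}) := by
  classical
  have : Fintype ι := Fintype.ofFinite ι
  suffices H : ∀ (t : Finset ι) (p : ι → W), (∀ i ∈ t, p i ∈ Submodule.span R S) →
      (∀ i ∉ t, p i ∈ S) → f p ∈ Submodule.span R (f '' {q | ∀ i, q i ∈ S}) from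
    H Finset.univ p (fun i _ => hp i) fun i hi => (hi (Finset.mem_univ i)).elim
  intro t
  induction t using Finset.induction_on with
  | empty => exact fun p _ hp => Submodule.subset_span ⟨p, fun i => hp i (by simp), rfl⟩
  | insert j t hj ih =>
    intro p hp hp'
    suffices H : ∀ w ∈ Submodule.span R S, f (Function.update p j w) ∈
        Submodule.span R (f '' {q | ∀ i, q i ∈ S}) by
      have := H (p j) (hp j (Finset.mem_insert_self j t))
      rwa [Function.update_eq_self] at this
    intro w hw
    induction hw using Submodule.span_induction with
    | mem w hw =>
      refine ih _ (fun i hi => ?_) fun i hi => ?_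
      · rw [Function.update_of_ne (by rintro rfl; exact hj hi)]
        exact hp i (Finset.mem_insert_of_mem hi)
      · rcases eq_or_ne i j with rfl | hij
        · rwa [Function.update_self]
        · rw [Function.update_of_ne hij]
          exact hp' i (by simp [hij, hi])
    | zero => rw [f.map_update_zero]; exact Submodule.zero_mem _
    | add _ _ _ _ h h' => rw [f.map_update_add]; exact Submodule.add_mem _ h h'
    | smul a _ _ h => rw [f.map_update_smul]; exact Submodule.smul_mem _ a h

end algebra_lemmas

/-! ### Derivations of the function field and generalized Wronskians -/

section wronskian

variable {k : Type u} [Field k] [V.Over (Spec (.of k))]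

theorem constants_mem_localRing (c : k) (x : V) :
    algebraMap k V.functionField c ∈ localRing x :=
  toRat_mem (x := x) (U := ⊤) trivial
    (((V ↘ Spec (.of k)).appTop).hom ((Scheme.ΓSpecIso (.of k)).inv.hom c))

variable (V k) in
/-- The module of derivations of the function field of a scheme locally of finite type is
finite-dimensional. -/
theorem finite_derivation [LocallyOfFiniteType (V ↘ Spec (.of k))] :
    Module.Finite V.functionField (Derivation k V.functionField V.functionField) := by
  obtain ⟨U, hU, hη, -⟩ := exists_isAffineOpen_mem_and_subset
    (show genericPoint V ∈ (⊤ : V.Opens) from trivial)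
  have : Nonempty U := ⟨⟨_, hη⟩⟩
  have := functionField_isFractionRing_of_isAffineOpen V U hU
  have h1 := (V ↘ Spec (.of k)).finiteType_appLE (isAffineOpen_top (Spec (.of k))) hU le_top
  let φ : k →+* Γ(V, U) := ((V ↘ Spec (.of k)).appLE ⊤ U le_top).hom.comp
    (Scheme.ΓSpecIso (.of k)).inv.hom
  have h2 : φ.FiniteType :=
    h1.comp (RingHom.FiniteType.of_surjective _
      (ConcreteCategory.bijective_of_isIso (Scheme.ΓSpecIso (.of k)).inv).2)
  algebraize [φ]
  have : IsScalarTower k Γ(V, U) V.functionField := .of_algebraMap_eq fun c => by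
    change constants k c = toRat hη (((V ↘ Spec (.of k)).appLE ⊤ U le_top).hom _)
    dsimp only [Scheme.Hom.appLE]
    exact (toRat_res (homOfLE le_top) hη _).symm
  have : Algebra.EssFiniteType Γ(V, U) V.functionField :=
    .of_isLocalization _ (nonZeroDivisors Γ(V, U))
  have : Algebra.EssFiniteType k V.functionField := .comp k Γ(V, U) V.functionField
  exact Module.Finite.equiv (KaehlerDifferential.linearMapEquivDerivation k V.functionField)

variable (𝓛 : Submodule V.functionField (Derivation k V.functionField V.functionField))

/-- The vector `(a, da)` in `K ⊕ 𝓛^∨`; in terms of a basis of `𝓛` this is `(a, δ₁ a, …, δᵣ a)`. -/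
def jetVec (a : V.functionField) : V.functionField × Module.Dual V.functionField 𝓛 :=
  (a, ev 𝓛 a)

theorem ev_one : ev 𝓛 1 = 0 := by
  have h := ev_mul 𝓛 1 1
  rw [mul_one, one_smul] at h
  exact left_eq_add.mp h

theorem ev_zero : ev 𝓛 0 = 0 := LinearMap.ext fun δ => map_zero δ.1

variable [Module.Finite V.functionField 𝓛]

/-- The derivations in `𝓛` are separated by their values, so the `da` span `𝓛^∨`; the vector
`(1, d1) = (1, 0)` takes care of the first component. -/
theorem span_range_jetVec : Submodule.span V.functionField (Set.range (jetVec 𝓛)) = ⊤ := by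
  have h1 : jetVec 𝓛 1 = (1, 0) := by rw [jetVec, ev_one]
  have hev : Submodule.span V.functionField (Set.range (ev 𝓛)) = ⊤ :=
    Submodule.span_eq_top_of_ne_zero fun δ hδ => by
      by_contra! h
      exact hδ (Subtype.ext <| Derivation.ext fun a => h _ ⟨a, rfl⟩)
  have h2 : ∀ ω : Module.Dual V.functionField 𝓛,
      (0, ω) ∈ Submodule.span V.functionField (Set.range (jetVec 𝓛)) := fun ω => by
    have hω : ω ∈ Submodule.span V.functionField (Set.range (ev 𝓛)) := hev ▸ trivial
    induction hω using Submodule.span_induction with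
    | mem ω h =>
      obtain ⟨a, rfl⟩ := h
      have : ((0, ev 𝓛 a) : V.functionField × Module.Dual V.functionField 𝓛) =
          jetVec 𝓛 a - a • jetVec 𝓛 1 := by
        rw [h1, jetVec, Prod.smul_mk, Prod.mk_sub_mk]
        simp
      rw [this]
      exact Submodule.sub_mem _ (Submodule.subset_span ⟨a, rfl⟩)
        (Submodule.smul_mem _ _ (Submodule.subset_span ⟨1, rfl⟩))
    | zero => exact Submodule.zero_mem _
    | add ω ω' _ _ h h' =>
      have := Submodule.add_mem _ h h'
      rwa [Prod.mk_add_mk, add_zero] at this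
    | smul c ω _ h =>
      have := Submodule.smul_mem _ c h
      rwa [Prod.smul_mk, smul_zero] at this
  rw [eq_top_iff]
  rintro ⟨a, ω⟩ -
  have : ((a, ω) : V.functionField × Module.Dual V.functionField 𝓛) = a • jetVec 𝓛 1 + (0, ω) := by
    rw [h1, Prod.smul_mk, Prod.mk_add_mk]
    simp
  rw [this]
  exact Submodule.add_mem _ (Submodule.smul_mem _ _ (Submodule.subset_span ⟨1, rfl⟩)) (h2 ω)

theorem finrank_jetSpace :
    Module.finrank V.functionField (V.functionField × Module.Dual V.functionField 𝓛) =
      folRank 𝓛 + 1 := by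
  rw [Module.finrank_prod, Module.finrank_self, Subspace.dual_finrank_eq, add_comm]

/-- An arbitrary basis of `K ⊕ 𝓛^∨`, used only to define determinants. -/
def jetBasis : Module.Basis (Fin (folRank 𝓛 + 1)) V.functionField
    (V.functionField × Module.Dual V.functionField 𝓛) :=
  Module.finBasisOfFinrankEq _ _ (finrank_jetSpace 𝓛)

/-- The generalized Wronskian of `a₀, …, aᵣ`: the determinant of the vectors `(aᵢ, daᵢ)`
with respect to the chosen basis. Another choice changes it by a constant factor in `K`. -/
def wronskian (a : Fin (folRank 𝓛 + 1) → V.functionField) : V.functionField :=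
  (jetBasis 𝓛).det fun i => jetVec 𝓛 (a i)

theorem exists_wronskian_ne_zero : ∃ a, wronskian 𝓛 a ≠ 0 := by
  by_contra! h
  have := MultilinearMap.map_mem_span (jetBasis 𝓛).det.toMultilinearMap
    (p := jetBasis 𝓛) (S := Set.range (jetVec 𝓛)) fun i => span_range_jetVec 𝓛 ▸ trivial
  have h0 : (jetBasis 𝓛).det.toMultilinearMap '' {q | ∀ i, q i ∈ Set.range (jetVec 𝓛)} ⊆ {0} := by
    rintro _ ⟨q, hq, rfl⟩
    choose a ha using hq
    obtain rfl : (fun i => jetVec 𝓛 (a i)) = q := funext ha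
    exact h a
  have := Submodule.span_mono h0 this
  rw [Submodule.span_zero_singleton, Submodule.mem_bot] at this
  exact one_ne_zero ((jetBasis 𝓛).det_self.symm.trans this)

/-- The Wronskian is homogeneous under multiplication of all its entries by a common factor `u`:
`(u a, d (u a))` is the image of `(a, da)` under the scalar `u` times a transvection. -/
theorem wronskian_mul (u : V.functionField) (a : Fin (folRank 𝓛 + 1) → V.functionField) :
    wronskian 𝓛 (fun i => a i * u) = u ^ (folRank 𝓛 + 1) * wronskian 𝓛 a := by
  rcases eq_or_ne u 0 with rfl | hu
  · have : jetVec 𝓛 0 = 0 := by rw [jetVec, ev_zero]; rfl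
    simp only [wronskian, mul_zero, this]
    rw [zero_pow (by omega), zero_mul]
    exact (jetBasis 𝓛).det.map_coord_zero 0 rfl
  let f : Module.Dual V.functionField (V.functionField × Module.Dual V.functionField 𝓛) :=
    LinearMap.fst _ _ _
  let T := u • LinearMap.transvection f (0, u⁻¹ • ev 𝓛 u)
  have hT : (fun i => jetVec 𝓛 (a i * u)) = T ∘ fun i => jetVec 𝓛 (a i) := by
    funext i
    simp only [T, Function.comp_apply, LinearMap.smul_apply, LinearMap.transvection.apply, jetVec,
      f, LinearMap.fst_apply, Prod.smul_mk, Prod.mk_add_mk, ev_mul, smul_add, smul_smul]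
    refine Prod.ext ?_ ?_
    · simp [mul_comm]
    · simp only
      rw [mul_comm u (a i * u⁻¹), mul_assoc (a i), inv_mul_cancel₀ hu, mul_one, add_comm]
  rw [wronskian, hT, Module.Basis.det_comp, LinearMap.det_smul, finrank_jetSpace,
    LinearMap.transvection.det]
  simp [f, wronskian]

end wronskian

/-! ### Determinants on top exterior powers -/

section linear_algebra

variable {K : Type*} [Field K] {W W' : Type*} [AddCommGroup W] [Module K W] [AddCommGroup W']
  [Module K W']

theorem map_mem_of_mem_span {O : Subring K} (g : W →ₗ[K] W') {S : Set W} {P : Submodule O W'}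
    (h : ∀ w ∈ S, g w ∈ P) {w : W} (hw : w ∈ Submodule.span O S) : g w ∈ P :=
  (Submodule.span_le (p := P.comap (g.restrictScalars O))).2 h hw

/-- The determinant does not vanish on the top exterior power, which is one-dimensional. -/
theorem alternatingMapLinearEquiv_det_injective {n : ℕ} (b : Module.Basis (Fin n) K W) :
    Function.Injective (exteriorPower.alternatingMapLinearEquiv b.det) := by
  have : Module.Finite K W := Module.Finite.of_basis b
  have h1 : Module.finrank K (⋀[K]^n W) = 1 := by
    rw [exteriorPower.finrank_eq, Module.finrank_eq_card_basis b, Fintype.card_fin,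
      Nat.choose_self]
  have h2 : exteriorPower.alternatingMapLinearEquiv b.det ≠ 0 := fun h => by
    have := exteriorPower.alternatingMapLinearEquiv_apply_ιMulti b.det b
    rw [h, b.det_self] at this
    exact zero_ne_one this
  exact (LinearMap.injective_iff_surjective_of_finrank_eq_finrank
    (h1.trans (Module.finrank_self K).symm)).2 (LinearMap.surjective h2)

end linear_algebra

/-! ### The generic fibre and the stalks of the sheaf of principal parts -/

section principal

variable {k : Type u} [Field k] [V.Over (Spec (.of k))]
variable (𝓛 : Submodule V.functionField (Derivation k V.functionField V.functionField))
variable {J : V.Modules} (c : GenericFiber J ≃ₗ[V.functionField] V.functionField)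

/-- The generic fibre of `Ω` lies in the dual of `𝓛`. -/
def omegaFiber : GenericFiber (Omega 𝓛) →ₗ[V.functionField] Module.Dual V.functionField 𝓛 :=
  latticeFiber _

theorem omegaFiber_dSec {U : V.Opens} {x : V} (hx : x ∈ U) (a : Γ(V, U)) :
    omegaFiber 𝓛 (gen hx (dSec 𝓛 U a)) = ev 𝓛 (toRat hx a) :=
  latticeFiber_gen _ _ _

theorem omegaFiber_mem {x : V} {m : GenericFiber (Omega 𝓛)} (hm : m ∈ stalkImage (Omega 𝓛) x) :
    omegaFiber 𝓛 m ∈ Submodule.span (localRing x) (ev 𝓛 '' (localRing x : Set V.functionField)) :=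
  latticeFiber_mem hm

/-- A coordinate on `J` maps the generic fibre of `JΩ` to the dual of `𝓛`. -/
def prodOmegaFiber : GenericFiber (prodSheaf J (Omega 𝓛)) →ₗ[V.functionField]
    Module.Dual V.functionField 𝓛 :=
  (TensorProduct.lid _ _).toLinearMap ∘ₗ TensorProduct.map c.toLinearMap (omegaFiber 𝓛) ∘ₗ
    prodFiber J (Omega 𝓛)

theorem prodOmegaFiber_mulSec {U : V.Opens} {x : V} (hx : x ∈ U) (s : Γ(J, U))
    (ω : Γ(Omega 𝓛, U)) : prodOmegaFiber 𝓛 c (gen hx (mulSec U s ω)) =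
      c (gen hx s) • omegaFiber 𝓛 (gen hx ω) := by
  simp only [prodOmegaFiber, LinearMap.comp_apply]
  rw [prodFiber_mulSec]
  rfl

theorem prodOmegaFiber_injective : Function.Injective (prodOmegaFiber 𝓛 c) := by
  have h1 : Function.Injective (omegaFiber 𝓛) := latticeFiber_injective _
  have h2 : Function.Injective (TensorProduct.map c.toLinearMap (omegaFiber 𝓛)) :=
    TensorProduct.map_injective_of_flat_flat _ _ c.injective h1
  have h3 : Function.Injective (prodFiber J (Omega 𝓛)) := latticeFiber_injective _
  exact fun m m' h => h3 (h2 ((TensorProduct.lid _ _).injective h))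

theorem prodOmegaFiber_mem {x : V} {m : GenericFiber (prodSheaf J (Omega 𝓛))}
    (hm : m ∈ stalkImage (prodSheaf J (Omega 𝓛)) x) : prodOmegaFiber 𝓛 c m ∈
      Submodule.span (localRing x)
        {ω | ∃ a ∈ frac c x, ∃ b ∈ localRing x, a • ev 𝓛 b = ω} := by
  have h : prodFiber J (Omega 𝓛) m ∈ _ := (prodFiber_image J (Omega 𝓛) x).subset ⟨m, hm, rfl⟩
  refine map_mem_of_mem_span ((TensorProduct.lid _ _).toLinearMap ∘ₗ
    TensorProduct.map c.toLinearMap (omegaFiber 𝓛)) ?_ h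
  rintro _ ⟨a, ha, b, hb, rfl⟩
  refine map_mem_of_mem_span (c a • LinearMap.id) ?_ (omegaFiber_mem 𝓛 hb)
  rintro _ ⟨b, hb, rfl⟩
  exact Submodule.subset_span ⟨c a, ⟨a, ha, rfl⟩, b, hb, rfl⟩

variable {𝓛} in
/-- The components in `J` and in `JΩ` of a section of `P(J)`. -/
def principalComponents {U : V.Opens} (p : Γ(principalParts 𝓛 J, U)) :
    Γ(J, U) × Γ(prodSheaf J (Omega 𝓛), U) := p

/-- Given a coordinate `c` on `J`, the principal part `(s, β)` is mapped to
`(c s, d(c s) + c β) ∈ K ⊕ 𝓛^∨`. The correction term `d(c s)` makes this map linear for the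
twisted action on `P(J)`. -/
def rowMap : {g : GenericFiber (principalParts 𝓛 J) →ₗ[V.functionField]
      V.functionField × Module.Dual V.functionField 𝓛 //
    ∀ (U : V.Opens) (h : genericPoint V ∈ U) (p : Γ(principalParts 𝓛 J, U)),
      g (gen h p) = jetVec 𝓛 (c (gen h (principalComponents p).1)) +
        (0, prodOmegaFiber 𝓛 c (gen h (principalComponents p).2))} :=
  fiberLift (M := principalParts 𝓛 J)
    (fun U h =>
      { toFun := fun p => jetVec 𝓛 (c (gen h (principalComponents p).1)) +
          (0, prodOmegaFiber 𝓛 c (gen h (principalComponents p).2))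
        map_zero' := by
          change jetVec 𝓛 (c (gen h 0)) + (0, prodOmegaFiber 𝓛 c (gen h 0)) = 0
          simp only [map_zero, jetVec, ev_zero]
          exact add_zero 0
        map_add' := fun p q => by
          change jetVec 𝓛 (c (gen h ((principalComponents p).1 + (principalComponents q).1))) +
            (0, prodOmegaFiber 𝓛 c
              (gen h ((principalComponents p).2 + (principalComponents q).2))) = _
          simp only [map_add, jetVec, ev_add, Prod.mk_add_mk, add_zero]
          congr 1
          abel })
    (fun U U' i h p => by
      change jetVec 𝓛 (c (gen h (J.presheaf.map i.op (principalComponents p).1))) +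
        (0, prodOmegaFiber 𝓛 c (gen h ((prodSheaf J (Omega 𝓛)).presheaf.map i.op
          (principalComponents p).2))) = _
      rw [gen_res, gen_res]
      rfl)
    (fun U h a p => by
      change jetVec 𝓛 (c (gen h (a • (principalComponents p).1))) +
        (0, prodOmegaFiber 𝓛 c (gen h (a • (principalComponents p).2 -
          mulSec U (principalComponents p).1 (dSec 𝓛 U a)))) = toRat h a •
            (jetVec 𝓛 (c (gen h (principalComponents p).1)) +
              (0, prodOmegaFiber 𝓛 c (gen h (principalComponents p).2)))
      rw [map_sub, gen_smul, gen_smul, map_sub, prodOmegaFiber_mulSec, omegaFiber_dSec, map_smul,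
        map_smul, smul_eq_mul, jetVec, jetVec, ev_mul]
      simp only [Prod.mk_add_mk, Prod.smul_mk, smul_add, smul_eq_mul, add_zero]
      congr 1
      abel)

theorem rowMap_gen {U : V.Opens} {x : V} (hx : x ∈ U) (p : Γ(principalParts 𝓛 J, U)) :
    (rowMap 𝓛 c).1 (gen hx p) = jetVec 𝓛 (c (gen hx (principalComponents p).1)) +
      (0, prodOmegaFiber 𝓛 c (gen hx (principalComponents p).2)) :=
  (rowMap 𝓛 c).2 U (generic_mem hx) p

theorem rowMap_jet {U : V.Opens} {x : V} (hx : x ∈ U) (s : Γ(J, U)) :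
    (rowMap 𝓛 c).1 (gen hx (jet 𝓛 U s)) = jetVec 𝓛 (c (gen hx s)) := by
  rw [rowMap_gen]
  change jetVec 𝓛 (c (gen hx s)) + (0, prodOmegaFiber 𝓛 c (gen hx 0)) = _
  rw [map_zero, map_zero]
  exact add_zero _

theorem rowMap_injective : Function.Injective (rowMap 𝓛 c).1 := by
  rw [injective_iff_map_eq_zero]
  intro m hm
  obtain ⟨U, hU, p, rfl⟩ := exists_gen m
  rw [rowMap_gen, jetVec, Prod.mk_add_mk, Prod.mk_eq_zero, add_zero] at hm
  obtain ⟨h1, h2⟩ := hm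
  rw [h1, ev_zero, zero_add] at h2
  rw [LinearEquiv.map_eq_zero_iff] at h1
  have h3 : gen hU (principalComponents p).2 = 0 := prodOmegaFiber_injective 𝓛 c <| by
    rw [h2, map_zero]
  have h4 : (principalComponents p).2 = 0 :=
    embedsInFiber_latticeSheaf _ U _ fun _ _ => h3
  obtain ⟨O, hO, i, j, e⟩ := exists_res_eq hU hU (principalComponents p).1 0
    (h1.trans (map_zero _).symm)
  have : (principalParts 𝓛 J).presheaf.map i.op p = 0 := Prod.ext (e.trans (map_zero _)) <| by
    change (prodSheaf J (Omega 𝓛)).presheaf.map i.op (principalComponents p).2 = 0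
    rw [h4, map_zero]
  rw [← gen_res i hO, this, map_zero]

/-- The stalks of `P(J)` are spanned by principal parts of elements of `J`, because
`(0, a db) = (b a, d (b a)) - b (a, da)`. -/
theorem rowMap_mem {x : V} {m : GenericFiber (principalParts 𝓛 J)}
    (hm : m ∈ stalkImage (principalParts 𝓛 J) x) :
    (rowMap 𝓛 c).1 m ∈ Submodule.span (localRing x) (jetVec 𝓛 '' frac c x) := by
  obtain ⟨U, hx, p, rfl⟩ := hm
  rw [rowMap_gen]
  refine Submodule.add_mem _ (Submodule.subset_span ⟨_, gen_mem_frac c hx _, rfl⟩) ?_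
  have h := prodOmegaFiber_mem 𝓛 c (x := x) ⟨U, hx, (principalComponents p).2, rfl⟩
  generalize prodOmegaFiber 𝓛 c (gen hx (principalComponents p).2) = ω at h
  induction h using Submodule.span_induction with
  | mem ω h =>
    obtain ⟨a, ha, b, hb, rfl⟩ := h
    have : ((0, a • ev 𝓛 b) : V.functionField × Module.Dual V.functionField 𝓛) =
        jetVec 𝓛 (b * a) - (⟨b, hb⟩ : localRing x) • jetVec 𝓛 a := by
      rw [Subring.smul_def, jetVec, jetVec, Prod.smul_mk, Prod.mk_sub_mk, ev_mul]
      simp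
    rw [this]
    exact Submodule.sub_mem _
      (Submodule.subset_span ⟨_, (frac c x).smul_mem ⟨b, hb⟩ ha, rfl⟩)
      (Submodule.smul_mem _ _ (Submodule.subset_span ⟨a, ha, rfl⟩))
  | zero => exact Submodule.zero_mem _
  | add ω ω' _ _ h h' =>
    have := Submodule.add_mem _ h h'
    rwa [Prod.mk_add_mk, add_zero] at this
  | smul d ω _ h =>
    have := Submodule.smul_mem _ d h
    rwa [Prod.smul_mk, smul_zero] at this

end principal

/-! ### Coordinates on the sheaves of determinants -/

section determinant

/-- The generic fibre of an exterior power lies in the exterior power of the generic fibre. -/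
def extFiber (n : ℕ) (M : V.Modules) : GenericFiber (extSheaf n M) →ₗ[V.functionField]
    ⋀[V.functionField]^n (GenericFiber M) :=
  latticeFiber _

theorem extFiber_wedgeSec (n : ℕ) {M : V.Modules} {U : V.Opens} {x : V} (hx : x ∈ U)
    (s : Fin n → Γ(M, U)) : extFiber n M (gen hx (wedgeSec n U s)) =
      exteriorPower.ιMulti V.functionField n fun i => gen hx (s i) :=
  latticeFiber_gen _ _ _

theorem extFiber_mem {n : ℕ} {M : V.Modules} {x : V} {m : GenericFiber (extSheaf n M)}
    (hm : m ∈ stalkImage (extSheaf n M) x) : extFiber n M m ∈ Submodule.span (localRing x)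
      {t | ∃ m : Fin n → GenericFiber M, (∀ i, m i ∈ stalkImage M x) ∧
        exteriorPower.ιMulti V.functionField n m = t} :=
  latticeFiber_mem hm

variable {k : Type u} [Field k] [V.Over (Spec (.of k))]
variable (𝓛 : Submodule V.functionField (Derivation k V.functionField V.functionField))
variable [Module.Finite V.functionField 𝓛]
variable {J : V.Modules} (c : GenericFiber J ≃ₗ[V.functionField] V.functionField)

/-- The determinant as a linear form on the top exterior power of `K ⊕ 𝓛^∨`. -/
def jetDet : ⋀[V.functionField]^(folRank 𝓛 + 1)
    (V.functionField × Module.Dual V.functionField 𝓛) →ₗ[V.functionField] V.functionField :=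
  exteriorPower.alternatingMapLinearEquiv (jetBasis 𝓛).det

theorem jetDet_ιMulti (p : Fin (folRank 𝓛 + 1) →
    V.functionField × Module.Dual V.functionField 𝓛) :
    jetDet 𝓛 (exteriorPower.ιMulti V.functionField _ p) = (jetBasis 𝓛).det p :=
  exteriorPower.alternatingMapLinearEquiv_apply_ιMulti _ _

theorem jetDet_injective : Function.Injective (jetDet 𝓛) := by
  exact alternatingMapLinearEquiv_det_injective (jetBasis 𝓛)

theorem jetDet_comp_injective : Function.Injective
    (jetDet 𝓛 ∘ₗ exteriorPower.map _ (rowMap 𝓛 c).1 ∘ₗ extFiber _ (principalParts 𝓛 J)) := by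
  have h1 : Function.Injective (exteriorPower.map (folRank 𝓛 + 1) (rowMap 𝓛 c).1) :=
    exteriorPower.map_injective_field (rowMap_injective 𝓛 c)
  have h2 : Function.Injective (extFiber (folRank 𝓛 + 1) (principalParts 𝓛 J)) :=
    latticeFiber_injective _
  exact fun m m' h => h2 (h1 (jetDet_injective 𝓛 h))

theorem jetDet_comp_detSec {U : V.Opens} {x : V} (hx : x ∈ U)
    (f : Fin (folRank 𝓛 + 1) → Γ(J, U)) :
    (jetDet 𝓛 ∘ₗ exteriorPower.map _ (rowMap 𝓛 c).1 ∘ₗ extFiber _ (principalParts 𝓛 J))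
      (gen (M := FSheaf 𝓛 J) hx (detSec 𝓛 U f)) = wronskian 𝓛 fun i => c (gen hx (f i)) := by
  change jetDet 𝓛 (exteriorPower.map _ (rowMap 𝓛 c).1 (extFiber _ (principalParts 𝓛 J)
    (gen hx (wedgeSec _ U fun i => jet 𝓛 U (f i))))) = _
  rw [extFiber_wedgeSec, exteriorPower.map_apply_ιMulti, jetDet_ιMulti, wronskian]
  congr 1
  exact funext fun i => rowMap_jet 𝓛 c hx (f i)

theorem exists_sections_wronskian_ne_zero :
    ∃ (U : V.Opens) (hU : genericPoint V ∈ U) (f : Fin (folRank 𝓛 + 1) → Γ(J, U)),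
      wronskian 𝓛 (fun i => c (gen hU (f i))) ≠ 0 := by
  obtain ⟨a, ha⟩ := exists_wronskian_ne_zero 𝓛
  obtain ⟨U, hU, f, hf⟩ := exists_common_section fun i => stalkImage_generic (c.symm (a i))
  refine ⟨U, hU, f, ?_⟩
  simpa only [hf, LinearEquiv.apply_symm_apply] using ha

/-- The coordinate on `F(J)` that sends `w(f₀, …, fᵣ)` to the Wronskian of the `fᵢ`. -/
def FCoord : GenericFiber (FSheaf 𝓛 J) ≃ₗ[V.functionField] V.functionField :=
  coordOfInjective (M := FSheaf 𝓛 J) _ (jetDet_comp_injective 𝓛 c) <| by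
    obtain ⟨U, hU, f, hf⟩ := exists_sections_wronskian_ne_zero 𝓛 c
    exact ⟨gen hU (detSec 𝓛 U f), (jetDet_comp_detSec 𝓛 c hU f).trans_ne hf⟩

theorem FCoord_detSec {U : V.Opens} {x : V} (hx : x ∈ U) (f : Fin (folRank 𝓛 + 1) → Γ(J, U)) :
    FCoord 𝓛 c (gen hx (detSec 𝓛 U f)) = wronskian 𝓛 fun i => c (gen hx (f i)) :=
  jetDet_comp_detSec 𝓛 c hx f

theorem wronskian_mem_frac {x : V} {a : Fin (folRank 𝓛 + 1) → V.functionField}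
    (ha : ∀ i, a i ∈ frac c x) : wronskian 𝓛 a ∈ frac (FCoord 𝓛 c) x := by
  choose m hm hma using ha
  obtain ⟨U, hx, f, hf⟩ := exists_common_section hm
  refine ⟨_, ⟨U, hx, detSec 𝓛 U f, rfl⟩, (FCoord_detSec 𝓛 c hx f).trans ?_⟩
  congr 1
  exact funext fun i => by rw [hf, hma]

theorem frac_FCoord (x : V) : frac (FCoord 𝓛 c) x =
    Submodule.span (localRing x) (wronskian 𝓛 '' {a | ∀ i, a i ∈ frac c x}) := by
  refine le_antisymm ?_ (Submodule.span_le.2 ?_)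
  · rintro _ ⟨m, hm, rfl⟩
    refine map_mem_of_mem_span (jetDet 𝓛 ∘ₗ exteriorPower.map _ (rowMap 𝓛 c).1) ?_
      (extFiber_mem hm)
    rintro _ ⟨p, hp, rfl⟩
    rw [LinearMap.comp_apply, exteriorPower.map_apply_ιMulti, jetDet_ιMulti]
    refine Submodule.span_mono ?_ (MultilinearMap.map_mem_span
      ((jetBasis 𝓛).det.toMultilinearMap.restrictScalars (localRing x))
      fun i => rowMap_mem 𝓛 c (hp i))
    rintro _ ⟨q, hq, rfl⟩
    choose a ha ha' using hq
    refine ⟨a, ha, ?_⟩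
    rw [wronskian, funext ha']
    rfl
  · rintro _ ⟨a, ha, rfl⟩
    exact wronskian_mem_frac 𝓛 c ha

/-- The coordinates on the sheaves `J_s` induced by a coordinate on `I`. -/
def JCoord : ∀ s, GenericFiber (JSheaf 𝓛 J s) ≃ₗ[V.functionField] V.functionField
  | 0 => c
  | s + 1 => prodCoord (JCoord s) (FCoord 𝓛 (JCoord s))

/-- The coordinates on the sheaves `L_s` induced by a coordinate on `I`. -/
def LCoord (s : ℕ) : GenericFiber (LSheaf 𝓛 J s) ≃ₗ[V.functionField] V.functionField :=
  FCoord 𝓛 (JCoord 𝓛 c s)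

theorem JCoord_mulSec {s : ℕ} {U : V.Opens} {x : V} (hx : x ∈ U) (f : Γ(JSheaf 𝓛 J s, U))
    (h : Γ(LSheaf 𝓛 J s, U)) :
    JCoord 𝓛 c (s + 1) (gen (M := JSheaf 𝓛 J (s + 1)) hx (mulSec U f h)) =
      JCoord 𝓛 c s (gen hx f) * LCoord 𝓛 c s (gen hx h) :=
  prodCoord_mulSec _ _ hx f h

/-- Inside the function field `L_s^{r+2}` is contained in `L_{s+1}`: for `h` and `w(f)` in `L_s`,
the element `h^{r+1} w(f)` is the Wronskian of the `h fᵢ`, and in characteristic zero these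
elements span `L_s^{r+2}`. -/
theorem frac_LCoord_pow_le [CharZero k] (s : ℕ) (x : V) :
    frac (LCoord 𝓛 c s) x ^ (folRank 𝓛 + 2) ≤ frac (LCoord 𝓛 c (s + 1)) x := by
  have : CharZero V.functionField := charZero_of_injective_algebraMap (algebraMap k _).injective
  rw [pow_succ]
  refine pow_mul_le_of_pow_mul_mem ?_ fun b hb d hd => ?_
  · have := constants_mem_localRing (V := V) (((folRank 𝓛 + 1).factorial : k)⁻¹) x
    rwa [map_inv₀, map_natCast] at this
  · have hd' := (frac_FCoord 𝓛 (JCoord 𝓛 c s) x).le hd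
    clear hd
    induction hd' using Submodule.span_induction with
    | mem _ h =>
      obtain ⟨a, ha, rfl⟩ := h
      rw [← wronskian_mul]
      refine wronskian_mem_frac 𝓛 _ fun i => ?_
      exact (frac_prodCoord _ _ x).ge (Submodule.mul_mem_mul (ha i) hb)
    | zero => rw [mul_zero]; exact Submodule.zero_mem _
    | add _ _ _ _ h h' => rw [mul_add]; exact Submodule.add_mem _ h h'
    | smul d _ _ h => rw [mul_smul_comm]; exact Submodule.smul_mem _ d h

end determinant

/-! ### Functoriality on sections -/

section naturality

variable {A A' B B' : V.Modules}

theorem powMap_powSec (φ : A ⟶ A') (U : V.Opens) (x : ℕ → Γ(A, U)) (n : ℕ) :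
    (powMap φ n).app U (powSec U x n) = powSec U (fun t => φ.app U (x t)) n := by
  induction n with
  | zero => rfl
  | succ n ih =>
    exact (prodMap_mulSec (powMap φ n) φ U _ _).trans (by rw [ih]; rfl)

theorem listMap_listSec {A A' : ℕ → V.Modules} (φ : ∀ s, A s ⟶ A' s) (U : V.Opens)
    (x : ∀ s, ℕ → Γ(A s, U)) (s : ℕ) (l : List ℕ) :
    (listMap φ s l).app U (listSec U x s l) = listSec U (fun s t => (φ s).app U (x s t)) s l := by
  induction l generalizing s with
  | nil => rfl
  | cons a l ih =>
    exact (prodMap_mulSec (powMap (φ s) a) (listMap φ (s + 1) l) U _ _).trans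
      (by rw [powMap_powSec, ih]; rfl)

theorem extMap_wedgeSec (n : ℕ) (φ : A ⟶ A') (U : V.Opens) (s : Fin n → Γ(A, U)) :
    (extMap n φ).app U (wedgeSec n U s) = wedgeSec n U fun i => φ.app U (s i) :=
  Subtype.ext <| funext fun x => by
    change exteriorPower.map n (genericMap φ) (exteriorPower.ιMulti _ n fun i => gen x.2 (s i)) =
      exteriorPower.ιMulti _ n fun i => gen x.2 (φ.app U (s i))
    rw [exteriorPower.map_apply_ιMulti]
    exact congrArg _ (funext fun i => genericMap_gen φ x.2 (s i))

variable {k : Type u} [Field k] [V.Over (Spec (.of k))]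
variable (𝓛 : Submodule V.functionField (Derivation k V.functionField V.functionField))

theorem principalMap_jet (φ : A ⟶ A') (U : V.Opens) (f : Γ(A, U)) :
    (principalMap 𝓛 φ).app U (jet 𝓛 U f) = jet 𝓛 U (φ.app U f) :=
  Prod.ext rfl (map_zero ((prodMap φ (𝟙 (Omega 𝓛))).app U).hom)

theorem FMap_detSec (φ : A ⟶ A') (U : V.Opens) (f : Fin (folRank 𝓛 + 1) → Γ(A, U)) :
    (FMap 𝓛 φ).app U (detSec 𝓛 U f) = detSec 𝓛 U fun i => φ.app U (f i) :=
  (extMap_wedgeSec _ (principalMap 𝓛 φ) U _).trans <|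
    congrArg (wedgeSec _ U) (funext fun i => principalMap_jet 𝓛 φ U (f i))

end naturality

/-! ### The maps from the power of one sheaf to the next -/

section carry_maps

variable {k : Type u} [Field k] [V.Over (Spec (.of k))]
variable (𝓛 : Submodule V.functionField (Derivation k V.functionField V.functionField))
variable {I : V.Modules}

theorem embedsInFiber_LSheaf (I : V.Modules) (s : ℕ) : EmbedsInFiber (LSheaf 𝓛 I s) :=
  embedsInFiber_latticeSheaf _

variable {𝓛} in
theorem StrongDetPower.detPower {s : ℕ}
    {ν : powSheaf (LSheaf 𝓛 I s) (folRank 𝓛 + 2) ⟶ LSheaf 𝓛 I (s + 1)}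
    (h : StrongDetPower ν) : DetPower ν :=
  fun U f => h U f (detSec 𝓛 U f)

/-- The section `w(f₀, …, fᵣ)` of `L_s` given by sections `fᵢ` of `J_s`. -/
def detSecL {s : ℕ} (U : V.Opens) (f : Fin (folRank 𝓛 + 1) → Γ(JSheaf 𝓛 I s, U)) :
    Γ(LSheaf 𝓛 I s, U) :=
  detSec 𝓛 U f

theorem LMap_detSecL {I' : V.Modules} (φ : I ⟶ I') {s : ℕ} (U : V.Opens)
    (f : Fin (folRank 𝓛 + 1) → Γ(JSheaf 𝓛 I s, U)) :
    (LMap 𝓛 φ s).app U (detSecL 𝓛 U f) = detSecL 𝓛 U fun i => (JMap 𝓛 φ s).app U (f i) :=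
  FMap_detSec 𝓛 (JMap 𝓛 φ s) U f

variable [Module.Finite V.functionField 𝓛]
variable (c : GenericFiber I ≃ₗ[V.functionField] V.functionField)

theorem LCoord_detSecL {s : ℕ} {U : V.Opens} {x : V} (hx : x ∈ U)
    (f : Fin (folRank 𝓛 + 1) → Γ(JSheaf 𝓛 I s, U)) :
    LCoord 𝓛 c s (gen hx (detSecL 𝓛 U f)) = wronskian 𝓛 fun i => JCoord 𝓛 c s (gen hx (f i)) :=
  FCoord_detSec 𝓛 _ hx f

/-- The map `ν_s : L_s^{r+2} → L_{s+1}`. In the coordinates on `L_s` and `L_{s+1}` given by the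
Wronskians, it is the product in the function field. -/
def nu [CharZero k] (s : ℕ) :
    powSheaf (LSheaf 𝓛 I s) (folRank 𝓛 + 2) ⟶ LSheaf 𝓛 I (s + 1) :=
  coordHom (embedsInFiber_LSheaf 𝓛 I (s + 1)) (powCoord (LCoord 𝓛 c s) (folRank 𝓛 + 2))
    (LCoord 𝓛 c (s + 1)) fun x =>
      (frac_powCoord _ x _).trans_le (frac_LCoord_pow_le 𝓛 c s x)

theorem LCoord_nu [CharZero k] (s : ℕ) {U : V.Opens} {x : V} (hx : x ∈ U)
    (m : Γ(powSheaf (LSheaf 𝓛 I s) (folRank 𝓛 + 2), U)) :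
    LCoord 𝓛 c (s + 1) (gen hx ((nu 𝓛 c s).app U m)) = powCoord (LCoord 𝓛 c s) _ (gen hx m) :=
  coordHom_app _ _ _ _ hx m

theorem strongDetPower_nu [CharZero k] (s : ℕ) : StrongDetPower (nu 𝓛 c s) := by
  intro U f h
  refine (embedsInFiber_LSheaf 𝓛 I (s + 1)).ext_coord (LCoord 𝓛 c (s + 1)) fun x hx => ?_
  refine (LCoord_nu 𝓛 c s hx _).trans (.trans ?_ (LCoord_detSecL 𝓛 c hx (s := s + 1) _).symm)
  refine (prodCoord_mulSec _ _ hx _ _).trans ?_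
  rw [powCoord_powSec, Finset.prod_const, Finset.card_range]
  simp only [JCoord_mulSec]
  rw [wronskian_mul]
  exact congrArg _ (LCoord_detSecL 𝓛 c hx f)

/-- A morphism out of `L_s^{r+2}` is determined by its values on the powers `w(f₀, …, fᵣ)^{r+2}`,
because there are `fᵢ` with nonzero Wronskian. -/
theorem hom_ext_detSec_pow (c : GenericFiber I ≃ₗ[V.functionField] V.functionField) {N : V.Modules} (hN : EmbedsInFiber N) (s : ℕ)
    {φ ψ : powSheaf (LSheaf 𝓛 I s) (folRank 𝓛 + 2) ⟶ N}
    (h : ∀ (U : V.Opens) (f : Fin (folRank 𝓛 + 1) → Γ(JSheaf 𝓛 I s, U)),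
      φ.app U (powSec U (fun _ => detSec 𝓛 U f) (folRank 𝓛 + 2)) =
        ψ.app U (powSec U (fun _ => detSec 𝓛 U f) (folRank 𝓛 + 2))) : φ = ψ := by
  obtain ⟨U, hU, f, hf⟩ := exists_sections_wronskian_ne_zero 𝓛 (JCoord 𝓛 c s)
  refine hN.hom_ext_of_section (powCoord (LCoord 𝓛 c s) _) hU _ ?_ (h U f)
  refine (powCoord_powSec (LCoord 𝓛 c s) hU (fun _ => detSecL 𝓛 U f) _).trans_ne ?_
  rw [Finset.prod_const, LCoord_detSecL]
  exact pow_ne_zero _ hf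

theorem nu_natural (c : GenericFiber I ≃ₗ[V.functionField] V.functionField) {I' : V.Modules} (φ : I ⟶ I') (s : ℕ)
    {ν : powSheaf (LSheaf 𝓛 I s) (folRank 𝓛 + 2) ⟶ LSheaf 𝓛 I (s + 1)}
    {ν' : powSheaf (LSheaf 𝓛 I' s) (folRank 𝓛 + 2) ⟶ LSheaf 𝓛 I' (s + 1)}
    (hν : DetPower ν) (hν' : DetPower ν') :
    powMap (LMap 𝓛 φ s) (folRank 𝓛 + 2) ≫ ν' = ν ≫ LMap 𝓛 φ (s + 1) := by
  refine hom_ext_detSec_pow 𝓛 c (embedsInFiber_LSheaf 𝓛 I' (s + 1)) s fun U f => ?_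
  change ν'.app U ((powMap (LMap 𝓛 φ s) (folRank 𝓛 + 2)).app U
      (powSec U (fun _ => detSecL 𝓛 U f) (folRank 𝓛 + 2))) =
    (LMap 𝓛 φ (s + 1)).app U (ν.app U (powSec U (fun _ => detSec 𝓛 U f) (folRank 𝓛 + 2)))
  rw [powMap_powSec, hν U f, LMap_detSecL]
  refine (hν' U _).trans (.trans ?_ (LMap_detSecL 𝓛 φ (s := s + 1) U _).symm)
  refine congrArg (detSecL 𝓛 (s := s + 1) U) (funext fun i => ?_)
  refine .trans ?_ (prodMap_mulSec (JMap 𝓛 φ s) (FMap 𝓛 (JMap 𝓛 φ s)) U _ _).symm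
  exact congrArg _ (LMap_detSecL 𝓛 φ U f).symm

end carry_maps

/-! ### Graded rings inside a polynomial ring -/

section graded_algebra

variable {R : ℕ → V.Modules} (ρ : ∀ i, GenericFiber (R i) ≃ₗ[V.functionField] V.functionField)

theorem gradedMonoid_mk_eq (hR : ∀ i, EmbedsInFiber (R i)) {U : V.Opens} {m n : ℕ} (h : m = n)
    {s : Γ(R m, U)} {t : Γ(R n, U)}
    (hst : ∀ x (hx : x ∈ U), ρ m (gen hx s) = ρ n (gen hx t)) :
    GradedMonoid.mk (A := fun n => Γ(R n, U)) m s = GradedMonoid.mk n t := by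
  subst h
  exact congrArg _ ((hR m).ext_coord (ρ m) hst)

variable {K : Type*} [CommRing K] {A : ℕ → Type*} [∀ i, AddCommGroup (A i)]
  [DirectSum.GCommRing A]

/-- The ring homomorphism `⨁ A_i → K[T]`, `a ↦ f_i(a) Tⁱ`, given by multiplicative maps
`f_i : A_i → K`. -/
def toPolynomial (f : ∀ i, A i →+ K) (h1 : f 0 GradedMonoid.GOne.one = 1)
    (hmul : ∀ {i j} (a : A i) (b : A j), f (i + j) (GradedMonoid.GMul.mul a b) = f i a * f j b) :
    (⨁ i, A i) →+* Polynomial K :=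
  DirectSum.toSemiring (fun i => (Polynomial.monomial i).toAddMonoidHom.comp (f i))
    (by
      change Polynomial.monomial 0 (f 0 GradedMonoid.GOne.one) = 1
      rw [h1, Polynomial.monomial_zero_one])
    (fun {i j} a b => by
      change Polynomial.monomial (i + j) (f (i + j) (GradedMonoid.GMul.mul a b)) =
        Polynomial.monomial i (f i a) * Polynomial.monomial j (f j b)
      rw [hmul, Polynomial.monomial_mul_monomial])

theorem toPolynomial_of (f : ∀ i, A i →+ K) (h1 : f 0 GradedMonoid.GOne.one = 1)
    (hmul : ∀ {i j} (a : A i) (b : A j), f (i + j) (GradedMonoid.GMul.mul a b) = f i a * f j b)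
    (i : ℕ) (a : A i) :
    toPolynomial f h1 hmul (DirectSum.of A i a) = Polynomial.C (f i a) * Polynomial.X ^ i :=
  (DirectSum.toSemiring_of _ _ _ i a).trans Polynomial.C_mul_X_pow_eq_monomial.symm

theorem toPolynomial_prod (f : ∀ i, A i →+ K) (h1 : f 0 GradedMonoid.GOne.one = 1)
    (hmul : ∀ {i j} (a : A i) (b : A j), f (i + j) (GradedMonoid.GMul.mul a b) = f i a * f j b)
    {ι : Type*} (s : Finset ι) (z : ι → ⨁ i, A i) :
    toPolynomial f h1 hmul (∏ i ∈ s, z i) = ∏ i ∈ s, toPolynomial f h1 hmul (z i) :=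
  map_prod _ _ _

theorem coeff_toPolynomial (f : ∀ i, A i →+ K) (h1 : f 0 GradedMonoid.GOne.one = 1)
    (hmul : ∀ {i j} (a : A i) (b : A j), f (i + j) (GradedMonoid.GMul.mul a b) = f i a * f j b)
    (z : ⨁ i, A i) (n : ℕ) : (toPolynomial f h1 hmul z).coeff n = f n (z n) := by
  induction z using DirectSum.induction_on with
  | zero => rw [map_zero, Polynomial.coeff_zero, DirectSum.zero_apply, map_zero]
  | of i s =>
    rw [toPolynomial_of, Polynomial.coeff_C_mul_X_pow]
    split_ifs with h
    · subst h
      rw [DirectSum.of_eq_same]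
    · rw [DirectSum.of_eq_of_ne _ _ _ h, map_zero]
  | add z z' h h' => rw [map_add, Polynomial.coeff_add, h, h', DirectSum.add_apply, map_add]

theorem sum_range_getD_mul_pow (b : ℕ) (l : List ℕ) :
    ∑ j ∈ Finset.range l.length, l.getD j 0 * b ^ j = Nat.ofDigits b l := by
  induction l with
  | nil => rfl
  | cons a l ih =>
    rw [List.length_cons, Finset.sum_range_succ', Nat.ofDigits_cons, ← ih, Finset.mul_sum, add_comm]
    simp only [List.getD_cons_zero, List.getD_cons_succ, pow_zero, mul_one, pow_succ]
    exact congrArg _ (Finset.sum_congr rfl fun j _ => by ring)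

theorem sum_digits_mul_pow (b n : ℕ) :
    ∑ j ∈ Finset.range (Nat.digits b n).length, b ^ j * (Nat.digits b n).getD j 0 = n := by
  refine .trans (Finset.sum_congr rfl fun j _ => mul_comm _ _) ?_
  rw [sum_range_getD_mul_pow, Nat.ofDigits_digits]

end graded_algebra

/-! ### The graded algebra defined by carrying -/

section carrying

variable {k : Type u} [Field k] [V.Over (Spec (.of k))]
variable (𝓛 : Submodule V.functionField (Derivation k V.functionField V.functionField))
variable {I : V.Modules}

theorem embedsInFiber_RSheaf (I : V.Modules) (i : ℕ) : EmbedsInFiber (RSheaf 𝓛 I i) :=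
  embedsInFiber_listProd _ _

theorem RMap_monomial {I' : V.Modules} (φ : I ⟶ I') (U : V.Opens) (i : ℕ)
    (y : ∀ s, ℕ → Γ(LSheaf 𝓛 I s, U)) : (RMap 𝓛 φ i).app U (monomial 𝓛 U i y) =
      monomial 𝓛 U i fun s t => (LMap 𝓛 φ s).app U (y s t) :=
  listMap_listSec (LMap 𝓛 φ) U y 0 _

variable {𝓛} in
/-- In every algebra defined by carrying, a sequence of sections `y_s` of `L_s` with
`ν_s(y_s^{r+2}) = y_{s+1}` is a sequence of powers of `y₀`, and the monomial in the `y_s` of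
degree `i` is `y₀ⁱ`. -/
theorem IsCarrying.of_monomial_eq_pow
    {ν : ∀ s, powSheaf (LSheaf 𝓛 I s) (folRank 𝓛 + 2) ⟶ LSheaf 𝓛 I (s + 1)}
    {𝒜 : GradedSheafAlgebra (RSheaf 𝓛 I)} (h𝒜 : IsCarrying ν 𝒜) {U : V.Opens}
    (y : ∀ s, Γ(LSheaf 𝓛 I s, U))
    (hy : ∀ s, y (s + 1) = (ν s).app U (powSec U (fun _ => y s) (folRank 𝓛 + 2))) (i : ℕ) :
    letI := 𝒜.gcommRing U
    DirectSum.of (fun n => Γ(RSheaf 𝓛 I n, U)) i (monomial 𝓛 U i fun s _ => y s) =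
      DirectSum.of (fun n => Γ(RSheaf 𝓛 I n, U)) ((folRank 𝓛 + 2) ^ 0) (ofL 𝓛 U 0 (y 0)) ^ i := by
  let _ := 𝒜.gcommRing U
  have hpow : ∀ s, DirectSum.of (fun n => Γ(RSheaf 𝓛 I n, U)) ((folRank 𝓛 + 2) ^ s)
      (ofL 𝓛 U s (y s)) = DirectSum.of (fun n => Γ(RSheaf 𝓛 I n, U)) ((folRank 𝓛 + 2) ^ 0)
        (ofL 𝓛 U 0 (y 0)) ^ (folRank 𝓛 + 2) ^ s := fun s => by
    induction s with
    | zero => exact (pow_one _).symm.trans (congrArg _ (pow_zero _).symm)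
    | succ s ih =>
      have := h𝒜.carry U s fun _ => y s
      rw [Finset.prod_const, Finset.card_range, ih, ← hy, ← pow_mul, ← pow_succ] at this
      exact this.symm
  rw [h𝒜.monomial_eq U i]
  refine (Finset.prod_congr rfl fun s _ => Finset.prod_congr rfl fun _ _ => hpow s).trans ?_
  simp only [Finset.prod_const, Finset.card_range, ← pow_mul]
  rw [Finset.prod_pow_eq_pow_sum]
  rw [sum_digits_mul_pow]

variable {𝓛} in
theorem IsCarrying.mul_monomial
    {ν : ∀ s, powSheaf (LSheaf 𝓛 I s) (folRank 𝓛 + 2) ⟶ LSheaf 𝓛 I (s + 1)}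
    {𝒜 : GradedSheafAlgebra (RSheaf 𝓛 I)} (h𝒜 : IsCarrying ν 𝒜) {U : V.Opens}
    (y : ∀ s, Γ(LSheaf 𝓛 I s, U))
    (hy : ∀ s, y (s + 1) = (ν s).app U (powSec U (fun _ => y s) (folRank 𝓛 + 2))) (i j : ℕ) :
    (𝒜.mul i j).app U (mulSec U (monomial 𝓛 U i fun s _ => y s) (monomial 𝓛 U j fun s _ => y s)) =
      monomial 𝓛 U (i + j) fun s _ => y s := by
  let _ := 𝒜.gcommRing U
  refine DirectSum.of_injective (β := fun n => Γ(RSheaf 𝓛 I n, U)) (i + j) ?_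
  rw [h𝒜.of_monomial_eq_pow y hy, pow_add, ← h𝒜.of_monomial_eq_pow y hy i,
    ← h𝒜.of_monomial_eq_pow y hy j]
  exact (DirectSum.of_mul_of _ _).symm

variable {𝓛} in
theorem IsCarrying.unit_eq
    {ν : ∀ s, powSheaf (LSheaf 𝓛 I s) (folRank 𝓛 + 2) ⟶ LSheaf 𝓛 I (s + 1)}
    {𝒜 : GradedSheafAlgebra (RSheaf 𝓛 I)} (h𝒜 : IsCarrying ν 𝒜) :
    𝒜.unit = 𝟙 (structureSheaf V) := by
  let _ := 𝒜.gcommRing (⊤ : V.Opens)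
  refine embedsInFiber_structureSheaf.hom_ext_of_section unitCoord (U := ⊤)
    (x := genericPoint V) trivial (1 : Γ(V, ⊤)) ((unitCoord_gen_one _).trans_ne one_ne_zero) ?_
  have h := h𝒜.monomial_eq ⊤ 0 0
  rw [Nat.digits_zero] at h
  exact (DirectSum.of_injective (β := fun n => Γ(RSheaf 𝓛 I n, (⊤ : V.Opens))) 0 h).symm

variable [Module.Finite V.functionField 𝓛]
variable (c : GenericFiber I ≃ₗ[V.functionField] V.functionField)

/-- The coordinates on the sheaves `R_i` induced by a coordinate on `I`. -/
def RCoord (i : ℕ) : GenericFiber (RSheaf 𝓛 I i) ≃ₗ[V.functionField] V.functionField :=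
  listCoord (LCoord 𝓛 c) 0 _

theorem RCoord_monomial {U : V.Opens} {x : V} (hx : x ∈ U) (i : ℕ)
    (y : ∀ s, ℕ → Γ(LSheaf 𝓛 I s, U)) : RCoord 𝓛 c i (gen hx (monomial 𝓛 U i y)) =
      ∏ s ∈ Finset.range (Nat.digits (folRank 𝓛 + 2) i).length,
        ∏ t ∈ Finset.range ((Nat.digits (folRank 𝓛 + 2) i).getD s 0),
          LCoord 𝓛 c s (gen hx (y s t)) := by
  have h : ∀ s, (fun t => LCoord 𝓛 c (0 + s) (gen hx (y (0 + s) t))) =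
      fun t => LCoord 𝓛 c s (gen hx (y s t)) := fun s => by rw [zero_add]
  refine (listCoord_listSec (LCoord 𝓛 c) hx y 0 _).trans ?_
  exact Finset.prod_congr rfl fun s _ => Finset.prod_congr rfl fun t _ => congrFun (h s) t

theorem RCoord_ofL {U : V.Opens} {x : V} (hx : x ∈ U) (s : ℕ) (y : Γ(LSheaf 𝓛 I s, U)) :
    RCoord 𝓛 c _ (gen hx (ofL 𝓛 U s y)) = LCoord 𝓛 c s (gen hx y) := by
  have hd : Nat.digits (folRank 𝓛 + 2) ((folRank 𝓛 + 2) ^ s) = List.replicate s 0 ++ [1] := by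
    have := Nat.digits_base_pow_mul (b := folRank 𝓛 + 2) (k := s) (m := 1) (by omega) one_pos
    rwa [mul_one, Nat.digits_of_lt _ 1 one_ne_zero (by omega)] at this
  rw [ofL, RCoord_monomial, hd]
  simp only [List.length_append, List.length_replicate, List.length_singleton]
  rw [Finset.prod_range_succ, Finset.prod_eq_one, one_mul]
  · rw [List.getD_append_right _ _ _ _ (by simp)]
    simp
  · intro j hj
    rw [List.getD_append _ _ _ _ (by simpa using hj)]
    simp

theorem frac_RCoord_mul_le [CharZero k] (i j : ℕ) (x : V) :
    frac (RCoord 𝓛 c i) x * frac (RCoord 𝓛 c j) x ≤ frac (RCoord 𝓛 c (i + j)) x := by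
  simp only [RCoord]
  erw [frac_listCoord, frac_listCoord, frac_listCoord]
  exact digitProd_mul_le (by omega) (fun s => frac_LCoord_pow_le 𝓛 c s x) 0 i j

/-- The multiplication `R_i R_j → R_{i+j}`, which in coordinates is that of the function field. -/
def RMul [CharZero k] (i j : ℕ) : prodSheaf (RSheaf 𝓛 I i) (RSheaf 𝓛 I j) ⟶ RSheaf 𝓛 I (i + j) :=
  coordHom (embedsInFiber_RSheaf 𝓛 I (i + j)) (prodCoord (RCoord 𝓛 c i) (RCoord 𝓛 c j))
    (RCoord 𝓛 c (i + j)) fun x => (frac_prodCoord _ _ x).trans_le (frac_RCoord_mul_le 𝓛 c i j x)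

theorem RCoord_RMul [CharZero k] {U : V.Opens} {x : V} (hx : x ∈ U) (i j : ℕ)
    (s : Γ(RSheaf 𝓛 I i, U)) (t : Γ(RSheaf 𝓛 I j, U)) :
    RCoord 𝓛 c (i + j) (gen hx ((RMul 𝓛 c i j).app U (mulSec U s t))) =
      RCoord 𝓛 c i (gen hx s) * RCoord 𝓛 c j (gen hx t) :=
  (coordHom_app _ _ _ _ hx _).trans (prodCoord_mulSec _ _ hx s t)

theorem RCoord_one {U : V.Opens} {x : V} (hx : x ∈ U) :
    RCoord 𝓛 c 0 (gen (M := RSheaf 𝓛 I 0) hx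
      ((𝟙 (structureSheaf V) : structureSheaf V ⟶ structureSheaf V).app U (1 : Γ(V, U)))) = 1 :=
  unitCoord_gen_one hx

/-- The graded algebra `⨁ R_i` with the multiplication of the function field. -/
def RAlgebra [CharZero k] : GradedSheafAlgebra (RSheaf 𝓛 I) where
  unit := 𝟙 (structureSheaf V)
  mul := RMul 𝓛 c
  one_mul U i s := gradedMonoid_mk_eq (RCoord 𝓛 c) (embedsInFiber_RSheaf 𝓛 I) (zero_add i)
    fun x hx => by rw [RCoord_RMul]; erw [RCoord_one]; rw [one_mul]
  mul_comm U i j s t := gradedMonoid_mk_eq (RCoord 𝓛 c) (embedsInFiber_RSheaf 𝓛 I) (add_comm i j)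
    fun x hx => by rw [RCoord_RMul, RCoord_RMul, mul_comm]
  mul_assoc U i j l s t w := gradedMonoid_mk_eq (RCoord 𝓛 c) (embedsInFiber_RSheaf 𝓛 I)
    (add_assoc i j l) fun x hx => by
      rw [RCoord_RMul, RCoord_RMul, RCoord_RMul, RCoord_RMul, mul_assoc]

/-- The coordinate `RCoord` as an additive map on sections. -/
def RCoordAt {U : V.Opens} {x : V} (hx : x ∈ U) (i : ℕ) :
    Γ(RSheaf 𝓛 I i, U) →+ V.functionField :=
  (RCoord 𝓛 c i).toLinearMap.toAddMonoidHom.comp (gen hx)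

/-- The ring homomorphism `⨁ Γ(R_i, U) → K[T]` that sends a section of `R_i` to its coordinate
times `Tⁱ`. It reduces identities between sections of `⨁ R_i` to identities of polynomials. -/
def RToPolynomial [CharZero k] {U : V.Opens} {x : V} (hx : x ∈ U) :
    letI := (RAlgebra 𝓛 c).gcommRing U
    (⨁ i, Γ(RSheaf 𝓛 I i, U)) →+* Polynomial V.functionField :=
  letI := (RAlgebra 𝓛 c).gcommRing U
  toPolynomial (RCoordAt 𝓛 c hx) (RCoord_one 𝓛 c hx) (RCoord_RMul 𝓛 c hx _ _)

theorem RToPolynomial_of [CharZero k] {U : V.Opens} {x : V} (hx : x ∈ U) (i : ℕ)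
    (s : Γ(RSheaf 𝓛 I i, U)) :
    RToPolynomial 𝓛 c hx (DirectSum.of (fun n => Γ(RSheaf 𝓛 I n, U)) i s) =
      Polynomial.C (RCoord 𝓛 c i (gen hx s)) * Polynomial.X ^ i :=
  let _ := (RAlgebra 𝓛 c).gcommRing U
  toPolynomial_of (RCoordAt 𝓛 c hx) _ _ i s

theorem RToPolynomial_prod [CharZero k] {U : V.Opens} {x : V} (hx : x ∈ U) {ι : Type*}
    (s : Finset ι) (z : ι → ⨁ i, Γ(RSheaf 𝓛 I i, U)) :
    letI := (RAlgebra 𝓛 c).gcommRing U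
    RToPolynomial 𝓛 c hx (∏ i ∈ s, z i) = ∏ i ∈ s, RToPolynomial 𝓛 c hx (z i) :=
  let _ := (RAlgebra 𝓛 c).gcommRing U
  toPolynomial_prod (RCoordAt 𝓛 c hx) _ _ s z

theorem eq_of_RToPolynomial_eq [CharZero k] {U : V.Opens} {z z' : ⨁ i, Γ(RSheaf 𝓛 I i, U)}
    (h : ∀ x (hx : x ∈ U), RToPolynomial 𝓛 c hx z = RToPolynomial 𝓛 c hx z') : z = z' :=
  DFinsupp.ext fun n => (embedsInFiber_RSheaf 𝓛 I n).ext_coord (RCoord 𝓛 c n) fun x hx => by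
    let _ := (RAlgebra 𝓛 c).gcommRing U
    have h' := congrArg (fun p => Polynomial.coeff p n) (h x hx)
    exact (coeff_toPolynomial (RCoordAt 𝓛 c hx) _ _ z n).symm.trans
      (h'.trans (coeff_toPolynomial (RCoordAt 𝓛 c hx) _ _ z' n))

theorem isCarrying_RAlgebra [CharZero k] : IsCarrying (nu 𝓛 c) (RAlgebra 𝓛 c) where
  monomial_eq U i y := by
    refine eq_of_RToPolynomial_eq 𝓛 c fun x hx => ?_
    simp only [map_prod, RToPolynomial_prod, RToPolynomial_of, RCoord_monomial, RCoord_ofL, Finset.prod_mul_distrib,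
      Finset.prod_const, Finset.card_range, ← pow_mul]
    rw [Finset.prod_pow_eq_pow_sum, sum_digits_mul_pow]
  carry U s y := by
    refine eq_of_RToPolynomial_eq 𝓛 c fun x hx => ?_
    simp only [map_prod, RToPolynomial_prod, RToPolynomial_of, RCoord_ofL, LCoord_nu, powCoord_powSec,
      Finset.prod_mul_distrib, Finset.prod_const, Finset.card_range, ← pow_mul, ← pow_succ]

/-- A morphism out of `R_i R_j` is determined by its values on products of monomials in sections
`y_s` of `L_s` with `ν_s(y_s^{r+2}) = y_{s+1}`: take `y₀` nonzero. -/
theorem hom_ext_monomial [CharZero k] {N : V.Modules} (hN : EmbedsInFiber N) (i j : ℕ)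
    {φ ψ : prodSheaf (RSheaf 𝓛 I i) (RSheaf 𝓛 I j) ⟶ N}
    (h : ∀ (U : V.Opens) (y : ∀ s, Γ(LSheaf 𝓛 I s, U)),
      (∀ s, y (s + 1) = (nu 𝓛 c s).app U (powSec U (fun _ => y s) (folRank 𝓛 + 2))) →
      φ.app U (mulSec U (monomial 𝓛 U i fun s _ => y s) (monomial 𝓛 U j fun s _ => y s)) =
        ψ.app U (mulSec U (monomial 𝓛 U i fun s _ => y s) (monomial 𝓛 U j fun s _ => y s))) :
    φ = ψ := by
  obtain ⟨U, hU, y₀, hy₀⟩ := exists_section_coord_ne_zero (LCoord 𝓛 c 0)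
  let y : ∀ s, Γ(LSheaf 𝓛 I s, U) := fun s => Nat.rec y₀
    (fun s y => (nu 𝓛 c s).app U (powSec U (fun _ => y) (folRank 𝓛 + 2))) s
  have hy : ∀ s, LCoord 𝓛 c s (gen hU (y s)) ≠ 0 := fun s => by
    induction s with
    | zero => exact hy₀
    | succ s ih =>
      change LCoord 𝓛 c (s + 1) (gen hU ((nu 𝓛 c s).app U _)) ≠ 0
      rw [LCoord_nu, powCoord_powSec, Finset.prod_const]
      exact pow_ne_zero _ ih
  refine hN.hom_ext_of_section (prodCoord (RCoord 𝓛 c i) (RCoord 𝓛 c j)) hU _ ?_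
    (h U y fun s => rfl)
  rw [prodCoord_mulSec, RCoord_monomial, RCoord_monomial]
  exact mul_ne_zero (Finset.prod_ne_zero_iff.2 fun s _ => Finset.prod_ne_zero_iff.2 fun _ _ => hy s)
    (Finset.prod_ne_zero_iff.2 fun s _ => Finset.prod_ne_zero_iff.2 fun _ _ => hy s)

theorem IsCarrying.eq_RAlgebra [CharZero k] {𝒜 : GradedSheafAlgebra (RSheaf 𝓛 I)}
    (h𝒜 : IsCarrying (nu 𝓛 c) 𝒜) : 𝒜 = RAlgebra 𝓛 c := by
  have hunit := h𝒜.unit_eq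
  have hmul : 𝒜.mul = RMul 𝓛 c := funext fun i => funext fun j =>
    hom_ext_monomial 𝓛 c (embedsInFiber_RSheaf 𝓛 I (i + j)) i j fun U y hy =>
      (h𝒜.mul_monomial y hy i j).trans ((isCarrying_RAlgebra 𝓛 c).mul_monomial y hy i j).symm
  cases 𝒜
  cases hunit
  cases hmul
  rfl

theorem RMul_natural [CharZero k] {I' : V.Modules}
    (c' : GenericFiber I' ≃ₗ[V.functionField] V.functionField) (φ : I ⟶ I') (i j : ℕ) :
    prodMap (RMap 𝓛 φ i) (RMap 𝓛 φ j) ≫ RMul 𝓛 c' i j = RMul 𝓛 c i j ≫ RMap 𝓛 φ (i + j) := by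
  refine hom_ext_monomial 𝓛 c (embedsInFiber_RSheaf 𝓛 I' (i + j)) i j fun U y hy => ?_
  change (RMul 𝓛 c' i j).app U ((prodMap (RMap 𝓛 φ i) (RMap 𝓛 φ j)).app U _) =
    (RMap 𝓛 φ (i + j)).app U ((RMul 𝓛 c i j).app U _)
  have h1 := (isCarrying_RAlgebra 𝓛 c).mul_monomial y hy i j
  have hy' : ∀ s, (LMap 𝓛 φ (s + 1)).app U (y (s + 1)) = (nu 𝓛 c' s).app U
      (powSec U (fun _ => (LMap 𝓛 φ s).app U (y s)) (folRank 𝓛 + 2)) := fun s => by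
    rw [hy s, ← powMap_powSec]
    have := nu_natural 𝓛 c φ s (strongDetPower_nu 𝓛 c s).detPower
      (strongDetPower_nu 𝓛 c' s).detPower
    exact (congrArg (fun ψ => ψ.app U (powSec U (fun _ => y s) (folRank 𝓛 + 2))) this).symm
  have h2 := (isCarrying_RAlgebra 𝓛 c').mul_monomial
    (fun s => (LMap 𝓛 φ s).app U (y s)) hy' i j
  rw [prodMap_mulSec, RMap_monomial, RMap_monomial]
  refine h2.trans (.trans ?_ (congrArg _ h1).symm)
  exact (RMap_monomial 𝓛 φ U (i + j) _).symm

end carrying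

end Foliation

end

theorem lemma1 {k : Type u} [Field k] [CharZero k]
    (V : Scheme.{u}) [AlgebraicGeometry.IsIntegral V] [V.Over (Spec (.of k))]
    [IsSeparated (V ↘ Spec (.of k))] [LocallyOfFiniteType (V ↘ Spec (.of k))]
    [QuasiCompact (V ↘ Spec (.of k))]
    (𝓛 : Submodule V.functionField (Derivation k V.functionField V.functionField)) :
    ∃ (ν : ∀ (I : TorsionFreeRankOne V) (s : ℕ),
          powSheaf (LSheaf 𝓛 I.sheaf s) (folRank 𝓛 + 2) ⟶ LSheaf 𝓛 I.sheaf (s + 1))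
      (𝒜 : ∀ I : TorsionFreeRankOne V, GradedSheafAlgebra (RSheaf 𝓛 I.sheaf)),
      (∀ (I : TorsionFreeRankOne V) (s : ℕ), DetPower (ν I s) ∧ StrongDetPower (ν I s) ∧
        ∀ ν', DetPower ν' → ν' = ν I s) ∧
      (∀ I : TorsionFreeRankOne V, (𝒜 I).unit = 𝟙 (structureSheaf V) ∧ IsCarrying (ν I) (𝒜 I) ∧
        ∀ 𝒜' : GradedSheafAlgebra (RSheaf 𝓛 I.sheaf), IsCarrying (ν I) 𝒜' → 𝒜' = 𝒜 I) ∧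
      (∀ (I I' : TorsionFreeRankOne V) (φ : I.sheaf ⟶ I'.sheaf),
        (∀ s, powMap (LMap 𝓛 φ s) (folRank 𝓛 + 2) ≫ ν I' s = ν I s ≫ LMap 𝓛 φ (s + 1)) ∧
        (∀ i j, prodMap (RMap 𝓛 φ i) (RMap 𝓛 φ j) ≫ (𝒜 I').mul i j =
          (𝒜 I).mul i j ≫ RMap 𝓛 φ (i + j))) := by
  have := finite_derivation V k
  let c (I : TorsionFreeRankOne V) : GenericFiber I.sheaf ≃ₗ[V.functionField] V.functionField :=
    have := Module.finite_of_finrank_pos (I.rank_one ▸ one_pos)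
    LinearEquiv.ofFinrankEq _ _ (I.rank_one.trans (Module.finrank_self _).symm)
  refine ⟨fun I => nu 𝓛 (c I), fun I => RAlgebra 𝓛 (c I), fun I s => ?_, fun I => ?_,
    fun I I' φ => ⟨fun s => ?_, RMul_natural 𝓛 (c I) (c I') φ⟩⟩
  · have h := (strongDetPower_nu 𝓛 (c I) s).detPower
    refine ⟨h, strongDetPower_nu 𝓛 (c I) s, fun ν' hν' => ?_⟩
    exact hom_ext_detSec_pow 𝓛 (c I) (embedsInFiber_LSheaf 𝓛 _ _) s fun U f =>
      (hν' U f).trans (h U f).symm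
  · exact ⟨rfl, isCarrying_RAlgebra 𝓛 (c I), fun _ h => h.eq_RAlgebra⟩
  · exact nu_natural 𝓛 (c I) φ s (strongDetPower_nu 𝓛 (c I) s).detPower
      (strongDetPower_nu 𝓛 (c I') s).detPower
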